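/- For positive integers $N,r$ let $S_{N,r}$ be the set of $r$-tuples of odd integers $n_i\ge 3$ with $n_1+\dots+n_r=N$. Let $\mathbf V_{N,r}\subset\mathbb Q[x_1,\dots,x_r]$ be the span of the monomials $x_1^{n_1-1}\cdots x_r^{n_r-1}$ with $(n_1,\dots,n_r)\in S_{N,r}$, let $\pi(P)=(a_n)_{n\in S_{N,r}}$ be the row vector of coefficients of $P=\sum_{n\in S_{N,r}} a_n x_1^{n_1-1}\cdots x_r^{n_r-1}\in\mathbf V_{N,r}$, and, for $r\ge 2$, let $$\mathbf W_{N,r}=\{P\in\mathbf V_{N,r} : P(x_1,\dots,x_r)=P(x_2-x_1,x_2,x_3,\dots,x_r)-P(x_2-x_1,x_1,x_3,\dots,x_r)\}.$$ For integers $m_i,n_i\ge1$ let $e\binom{m_1,\dots,m_r}{n_1,\dots,n_r}$ be the coefficient of $x_1^{n_1-1}\cdots x_r^{n_r-1}$ in $x_1^{m_1-1}\,\underline{\circ}\,(x_1^{m_2-1}\cdots x_{r-1}^{m_r-1})$, where for a monomial $f\in\mathbb Q[x_1]$ and a polynomial $g$ in $r-1$ variables $$(f\,\underline{\circ}\,g)(x_1,\dots,x_r)=f(x_1)g(x_2,\dots,x_r)+\sum_{i=1}^{r-1}\Bigl(f(x_{i+1}-x_i)\,g(x_1,\dots,\widehat{x_{i+1}},\dots,x_r)-(-1)^{\deg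 f}f(x_i-x_{i+1})\,g(x_1,\dots,\widehat{x_i},\dots,x_r)\Bigr).$$ Define matrices with rows $m$ and columns $n$ in $S_{N,r}$ by $E_{N,r}=\bigl(e\binom{m_1,\dots,m_r}{n_1,\dots,n_r}\bigr)$, by $E_{N,r}^{(j)}=\bigl(\delta_{(m_1,\dots,m_{r-j}),(n_1,\dots,n_{r-j})}\,e\binom{m_{r-j+1},\dots,m_r}{n_{r-j+1},\dots,n_r}\bigr)$ for $2\le j\le r$, and by $C_{N,r}=E_{N,r}^{(2)}E_{N,r}^{(3)}\cdots E_{N,r}^{(r-1)}E_{N,r}$. For a matrix $A$, $\ker A$ denotes the space of its right annihilators. Put $$\mathbb O(x)=\frac{x^3}{1-x^2},\qquad \mathbb S(x)=\frac{x^{12}}{(1-x^4)(1-x^6)}.$$ Assume that for all $r\ge2$ and all $N$ Tasaka's map $\mathbf W_{N,r}\to\ker{}^tE_{N,r}$, $P\mapsto\pi(P)(E_{N,r}-\mathrm{id})$, is injective. Then Tasaka's map is an isomorphism for $r=3$ and all $N$ if and only if $$\sum_{N>0}\dim_{\mathbb Q}\ker{}^tE_{N,3}\,x^N=\mathbb O(x)\,\mathbb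 S(x),$$ and if this holds, then $$\sum_{N>0}\dim_{\mathbb Q}\ker C_{N,5}\,x^N\ \ge\ 4\,\mathbb O(x)^3\,\mathbb S(x)-3\,\mathbb O(x)\,\mathbb S(x)^2,$$ meaning that for every $N$ the coefficient of $x^N$ on the right does not exceed that on the left. -/

import Mathlib

noncomputable section

namespace TotallyOdd

/-- The totally odd index set `S_{N,r}`: tuples of odd integers `≥ 3` with sum `N`. -/
def oddIndices (N r : ℕ) : Finset (Fin r → ℕ) :=
  (Finset.Nat.antidiagonalTuple r N).filter fun n => ∀ i, 3 ≤ n i ∧ Odd (n i)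

/-- `S_{N,r}` as a type, used to index rows and columns of matrices. -/
abbrev Idx (N r : ℕ) : Type := ↥(oddIndices N r)

/-- The exponent vector of `x₁^{m₁-1} ⋯ x_r^{m_r-1}`. -/
def expo {r : ℕ} (m : Fin r → ℕ) : Fin r →₀ ℕ :=
  Finsupp.equivFunOnFinite.symm fun i => m i - 1

/-- The space `V_{N,r}` of restricted totally even homogeneous polynomials. -/
def V (N r : ℕ) : Submodule ℚ (MvPolynomial (Fin r) ℚ) :=
  Submodule.span ℚ (Set.range fun m : Idx N r => MvPolynomial.monomial (expo m.1) (1 : ℚ))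

/-- The coefficient vector `(a_n)_{n ∈ S_{N,r}}` of a polynomial; on `V_{N,r}` this is the natural
isomorphism `π` onto the vectors indexed by `S_{N,r}`. -/
def coeffVec (N r : ℕ) : MvPolynomial (Fin r) ℚ →ₗ[ℚ] (Idx N r → ℚ) :=
  LinearMap.pi fun n => MvPolynomial.lcoeff ℚ (expo n.1)

/-- The substitution `P ↦ P(x₂ - x₁, x₂, x₃, …, x_r)`. -/
def substA (r : ℕ) (hr : 2 ≤ r) : MvPolynomial (Fin r) ℚ →ₐ[ℚ] MvPolynomial (Fin r) ℚ :=
  MvPolynomial.aeval fun i =>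
    if (i : ℕ) = 0 then MvPolynomial.X ⟨1, by omega⟩ - MvPolynomial.X ⟨0, by omega⟩
    else MvPolynomial.X i

/-- The substitution `P ↦ P(x₂ - x₁, x₁, x₃, …, x_r)`. -/
def substB (r : ℕ) (hr : 2 ≤ r) : MvPolynomial (Fin r) ℚ →ₐ[ℚ] MvPolynomial (Fin r) ℚ :=
  MvPolynomial.aeval fun i =>
    if (i : ℕ) = 0 then MvPolynomial.X ⟨1, by omega⟩ - MvPolynomial.X ⟨0, by omega⟩
    else if (i : ℕ) = 1 then MvPolynomial.X ⟨0, by omega⟩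
    else MvPolynomial.X i

/-- The space `W_{N,r}` of all `P ∈ V_{N,r}` with
`P(x₁, …, x_r) = P(x₂ - x₁, x₂, x₃, …, x_r) - P(x₂ - x₁, x₁, x₃, …, x_r)`. -/
def W (N r : ℕ) (hr : 2 ≤ r) : Submodule ℚ (MvPolynomial (Fin r) ℚ) :=
  V N r ⊓ LinearMap.eqLocus LinearMap.id ((substA r hr).toLinearMap - (substB r hr).toLinearMap)

/-- The polynomial representation of the Ihara action,
`f(x₁) g(x₂, …, x_r) + ∑_{i=1}^{r-1} (f(x_{i+1} - x_i) g(x₁, …, x̂_{i+1}, …, x_r)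
  - (-1)^{deg f} f(x_i - x_{i+1}) g(x₁, …, x̂_i, …, x_r))`, where `r = s + 1`.
Because of the sign `(-1)^{deg f}` it is only meant for homogeneous `f`; below `f` is a monomial. -/
def ihara {s : ℕ} (f : Polynomial ℚ) (g : MvPolynomial (Fin s) ℚ) :
    MvPolynomial (Fin (s + 1)) ℚ :=
  Polynomial.aeval (MvPolynomial.X 0) f * MvPolynomial.rename Fin.succ g +
    ∑ i : Fin s,
      (Polynomial.aeval (MvPolynomial.X i.succ - MvPolynomial.X i.castSucc) f *
          MvPolynomial.rename (Fin.succAbove i.succ) g -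
        (-1) ^ f.natDegree *
          Polynomial.aeval (MvPolynomial.X i.castSucc - MvPolynomial.X i.succ) f *
          MvPolynomial.rename (Fin.succAbove i.castSucc) g)

/-- The number `e(m₁, …, m_r; n₁, …, n_r)`: the coefficient of `x₁^{n₁-1} ⋯ x_r^{n_r-1}` in the Ihara
action of `x₁^{m₁-1}` on `x₁^{m₂-1} ⋯ x_{r-1}^{m_r-1}`. (Only `r ≥ 1` is relevant.) -/
def e : {r : ℕ} → (Fin r → ℕ) → (Fin r → ℕ) → ℚ
  | 0, _, _ => 0
  | _ + 1, m, n =>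
    MvPolynomial.coeff (expo n)
      (ihara (Polynomial.X ^ (m 0 - 1))
        (MvPolynomial.monomial (expo fun i => m i.succ) (1 : ℚ)))

/-- The matrix `E_{N,r}`. -/
def E (N r : ℕ) : Matrix (Idx N r) (Idx N r) ℚ :=
  Matrix.of fun m n => e m.1 n.1

/-- The last `j` entries `(m_{r-j+1}, …, m_r)` of an `r`-tuple. -/
def lastEntries {r j : ℕ} (h : j ≤ r) (m : Fin r → ℕ) : Fin j → ℕ :=
  fun i => m ⟨r - j + i, by omega⟩

/-- The matrix `E_{N,r}^{(j)}` (only `2 ≤ j ≤ r` is relevant; it is set to `0` for `j > r`). -/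
def Ej (N r j : ℕ) : Matrix (Idx N r) (Idx N r) ℚ :=
  Matrix.of fun m n =>
    if h : j ≤ r then
      if ∀ i : Fin r, (i : ℕ) < r - j → m.1 i = n.1 i then
        e (lastEntries h m.1) (lastEntries h n.1)
      else 0
    else 0

/-- The matrix `C_{N,r} = E_{N,r}^{(2)} E_{N,r}^{(3)} ⋯ E_{N,r}^{(r-1)} E_{N,r}`;
`List.range' 2 (r - 2)` is the list `[2, 3, …, r - 1]`. -/
def C (N r : ℕ) : Matrix (Idx N r) (Idx N r) ℚ :=
  ((List.range' 2 (r - 2)).map fun j => Ej N r j).prod * E N r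

/-- The space of right annihilators of a square matrix. -/
def rightKer {ι : Type} [Fintype ι] (A : Matrix ι ι ℚ) : Submodule ℚ (ι → ℚ) :=
  LinearMap.ker A.mulVecLin

/-- Tasaka's map `P ↦ π(P) F_{N,r}` on `W_{N,r}`, with `F_{N,r} = E_{N,r} - id`, as a map into the
space of all row vectors indexed by `S_{N,r}`. -/
def tasakaMap (N r : ℕ) (hr : 2 ≤ r) : W N r hr →ₗ[ℚ] (Idx N r → ℚ) :=
  (Matrix.vecMulLinear (E N r - 1)).comp ((coeffVec N r).comp (W N r hr).subtype)

/-- For all weights `N`, Tasaka's map in depth `r` is an isomorphism from `W_{N,r}` onto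
`ker ᵗE_{N,r}`. -/
def TasakaIso (r : ℕ) (hr : 2 ≤ r) : Prop :=
  ∀ N : ℕ, Function.Injective (tasakaMap N r hr) ∧
    LinearMap.range (tasakaMap N r hr) = rightKer (E N r).transpose

/-- The formal power series `∑_{N > 0} d(N) x^N`. -/
def genSeries (d : ℕ → ℕ) : PowerSeries ℚ :=
  PowerSeries.mk fun N => if 0 < N then (d N : ℚ) else 0

/-- `𝕆(x) = x³ / (1 - x²)`. -/
def oddSeries : PowerSeries ℚ :=
  PowerSeries.X ^ 3 * (1 - PowerSeries.X ^ 2)⁻¹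

/-- `𝕊(x) = x¹² / ((1 - x⁴)(1 - x⁶))`. -/
def cuspSeries : PowerSeries ℚ :=
  PowerSeries.X ^ 12 * ((1 - PowerSeries.X ^ 4) * (1 - PowerSeries.X ^ 6))⁻¹

end TotallyOdd

end

/-!
The left and right kernels of a square matrix have the same dimension, so the matrices may be viewed
as acting on row vectors, that is, on the free algebra on odd letters `≥ 3`. There `E` is the
Ihara action `act` of the first letter of a word on the rest, `E^(j)` is the same map on the last
`j` letters, and `C` is the total action `fullAct`, built up letter by letter.

In depth `2` the space `W` consists of even period polynomials: the antisymmetric binary forms in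
the kernel of the sum over an order-`3` rotation. The image of that sum is the space of alternating
forms, and counting dimensions gives `𝕊` as the generating series of `dim W_{N,2}`. If `P` is a
period polynomial and `w` a word, then on `P·w` the map `act + tailMap act` is the identity and
`act ∘ tailMap act` vanishes. Hence Tasaka's map is `-tailMap act` on `W` and takes values in
the left kernel of `E`, and the kernel `K r` of the total action contains both
`𝕆·K (r - 1)` and `W·Words (r - 2)`. If Tasaka's map is injective, these two subspaces meet only in
`W·K (r - 2)`. So, on generating series,
`D r = K r - 𝕆 K (r - 1) - 𝕊 (𝕆 ^ (r - 2) - K (r - 2))` has nonnegative coefficients, and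

  `K 5 - (4 𝕆³ 𝕊 - 3 𝕆 𝕊²) = D 5 + 𝕆 D 4 + (𝕆² - 𝕊) D 3 + 𝕆 (𝕆² - 2 𝕊) D 2`

is nonnegative because `𝕆² - 2 𝕊` is: `dim W_{N,2}` is at most half the number of pairs of letters
of weight `N`.
-/

noncomputable section

namespace TotallyOdd

open MvPolynomial

section

variable {σ R : Type*} [CommRing R] [IsDomain R] {p q : MvPolynomial σ R} {m d : ℕ}

lemma isHomogeneous_of_mul_left (hp : p.IsHomogeneous m) (hp0 : p ≠ 0)
    (hpq : (p * q).IsHomogeneous (m + d)) : q.IsHomogeneous d := by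
  let _ := gradedAlgebra (σ := σ) (R := R)
  have hcomp : p * homogeneousComponent d q = p * q := by
    have h := DirectSum.coe_decompose_mul_add_of_left_mem (homogeneousSubmodule σ R) (j := d)
      (b := q) hp
    rw [DirectSum.decompose_of_mem_same _ hpq] at h
    exact (congrArg (p * ·) (decomposition.decompose'_apply q d).symm).trans h.symm
  rw [← mul_left_cancel₀ hp0 hcomp]
  exact homogeneousComponent_isHomogeneous d q

lemma isRelPrime_X_of_eval_ne_zero {i : σ} (v : σ → R) (hv : v i = 0) (hp : eval v p ≠ 0) :
    IsRelPrime (X i) p := by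
  refine (X_prime (R := R)).irreducible.isRelPrime_iff_not_dvd.2 fun hdvd => hp ?_
  simpa [hv] using map_dvd (eval v) hdvd

end

/-! ### Alternating binary forms -/

/-- The substitution `P ↦ P(x - y, x)` on binary forms; on forms of even degree it has order `3`. -/
def rot : MvPolynomial (Fin 2) ℚ →ₐ[ℚ] MvPolynomial (Fin 2) ℚ := aeval ![X 0 - X 1, X 0]

/-- The substitution `P ↦ P(y, x)` on binary forms. -/
def flp : MvPolynomial (Fin 2) ℚ →ₐ[ℚ] MvPolynomial (Fin 2) ℚ := aeval ![X 1, X 0]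

@[simp] lemma rot_X_zero : rot (X 0) = X 0 - X 1 := by simp [rot]
@[simp] lemma rot_X_one : rot (X 1) = X 0 := by simp [rot]
@[simp] lemma flp_X_zero : flp (X 0) = X 1 := by simp [flp]
@[simp] lemma flp_X_one : flp (X 1) = X 0 := by simp [flp]

/-- The space of binary forms of degree `d`. -/
abbrev binaryForms (d : ℕ) : Submodule ℚ (MvPolynomial (Fin 2) ℚ) :=
  homogeneousSubmodule (Fin 2) ℚ d

lemma monomial_fin_two {R : Type*} [CommSemiring R] (e : Fin 2 →₀ ℕ) (c : R) :
    monomial e c = c • (X 0 ^ e 0 * X 1 ^ e 1) := by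
  rw [monomial_eq, Finsupp.prod_fintype _ _ (by simp), Fin.prod_univ_two, smul_eq_C_mul]

lemma binaryForms_le_span (d : ℕ) :
    binaryForms d ≤ Submodule.span ℚ {P | ∃ i j, i + j = d ∧ P = X 0 ^ i * X 1 ^ j} := by
  intro P hP
  rw [P.as_sum]
  refine Submodule.sum_mem _ fun e he => ?_
  rw [monomial_fin_two]
  refine Submodule.smul_mem _ _ (Submodule.subset_span ⟨e 0, e 1, ?_, rfl⟩)
  rw [← hP (mem_support_iff.1 he), Finsupp.weight_apply, Finsupp.sum_fintype _ _ (by simp)]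
  simp

lemma binaryForms_eqOn {M : Type*} [AddCommGroup M] [Module ℚ M] {d : ℕ}
    {f g : MvPolynomial (Fin 2) ℚ →ₗ[ℚ] M}
    (h : ∀ i j, i + j = d → f (X 0 ^ i * X 1 ^ j) = g (X 0 ^ i * X 1 ^ j))
    {P : MvPolynomial (Fin 2) ℚ} (hP : P ∈ binaryForms d) : f P = g P := by
  refine LinearMap.eqOn_span (s := {P | ∃ i j, i + j = d ∧ P = X 0 ^ i * X 1 ^ j}) ?_
    (binaryForms_le_span d hP)
  rintro _ ⟨i, j, hij, rfl⟩
  exact h i j hij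

instance (d : ℕ) : FiniteDimensional ℚ (binaryForms d) :=
  Module.Finite.iff_fg.2 (homogeneousSubmodule_fg _ _ d)

lemma X_pow_mul_X_pow_mem_binaryForms {d i j : ℕ} (h : i + j = d) :
    X 0 ^ i * X 1 ^ j ∈ binaryForms d :=
  h ▸ (isHomogeneous_X_pow 0 i).mul (isHomogeneous_X_pow 1 j)

section

variable {d : ℕ} {P : MvPolynomial (Fin 2) ℚ}

lemma rot_mem_binaryForms (hP : P ∈ binaryForms d) : rot P ∈ binaryForms d := by
  have hX : ∀ i, (![X 0 - X 1, X 0] i : MvPolynomial (Fin 2) ℚ).IsHomogeneous 1 :=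
    Fin.forall_fin_two.2 ⟨(isHomogeneous_X _ _).sub (isHomogeneous_X _ _), isHomogeneous_X _ _⟩
  exact one_mul d ▸ IsHomogeneous.aeval hP _ hX

lemma flp_mem_binaryForms (hP : P ∈ binaryForms d) : flp P ∈ binaryForms d := by
  have hX : ∀ i, (![X 1, X 0] i : MvPolynomial (Fin 2) ℚ).IsHomogeneous 1 :=
    Fin.forall_fin_two.2 ⟨isHomogeneous_X _ _, isHomogeneous_X _ _⟩
  exact one_mul d ▸ IsHomogeneous.aeval hP _ hX

lemma flp_flp (P : MvPolynomial (Fin 2) ℚ) : flp (flp P) = P := by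
  have h : flp.comp flp = AlgHom.id ℚ _ := by
    ext i; fin_cases i <;> simp
  exact congr($h P)

lemma rot_rot_rot (hd : Even d) (hP : P ∈ binaryForms d) : rot (rot (rot P)) = P := by
  refine binaryForms_eqOn (f := rot.toLinearMap ∘ₗ rot.toLinearMap ∘ₗ rot.toLinearMap)
    (g := LinearMap.id) ?_ hP
  rintro i j rfl
  simp only [LinearMap.comp_apply, AlgHom.toLinearMap_apply, map_mul, map_pow, rot_X_zero,
    rot_X_one, map_sub, LinearMap.id_apply]
  calc (X 0 - X 1 - X 0 - (X 0 - X 1)) ^ i * (X 0 - X 1 - X 0) ^ j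
      = (-1 * X 0) ^ i * (-1 * X 1) ^ j := by ring
    _ = (-1) ^ (i + j) * (X 0 ^ i * X 1 ^ j : MvPolynomial (Fin 2) ℚ) := by
        rw [mul_pow, mul_pow]; ring
    _ = X 0 ^ i * X 1 ^ j := by rw [hd.neg_one_pow, one_mul]

lemma flp_rot (hd : Even d) (hP : P ∈ binaryForms d) : flp (rot P) = rot (rot (flp P)) := by
  refine binaryForms_eqOn (f := flp.toLinearMap ∘ₗ rot.toLinearMap)
    (g := rot.toLinearMap ∘ₗ rot.toLinearMap ∘ₗ flp.toLinearMap) ?_ hP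
  rintro i j rfl
  simp only [LinearMap.comp_apply, AlgHom.toLinearMap_apply, map_mul, map_pow, rot_X_zero,
    rot_X_one, map_sub, flp_X_zero, flp_X_one]
  calc (X 1 - X 0) ^ i * X 1 ^ j
      = (-1 * (X 0 - X 1)) ^ i * X 1 ^ j := by ring
    _ = (-1) ^ i * ((X 0 - X 1) ^ i * X 1 ^ j : MvPolynomial (Fin 2) ℚ) := by
        rw [mul_pow]; ring
    _ = (-1) ^ j * ((X 0 - X 1) ^ i * X 1 ^ j) := by
        rw [neg_one_pow_congr (Nat.even_add.1 hd)]
    _ = (X 0 - X 1) ^ i * (-1 * X 1) ^ j := by rw [mul_pow]; ring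
    _ = (X 0 - X 1) ^ i * (X 0 - X 1 - X 0) ^ j := by ring

/-- The sum of a binary form over the three rotations. -/
def rotSum : MvPolynomial (Fin 2) ℚ →ₗ[ℚ] MvPolynomial (Fin 2) ℚ :=
  LinearMap.id + rot.toLinearMap + rot.toLinearMap ∘ₗ rot.toLinearMap

lemma rotSum_apply (P : MvPolynomial (Fin 2) ℚ) : rotSum P = P + rot P + rot (rot P) := rfl

lemma rotSum_rot (hd : Even d) (hP : P ∈ binaryForms d) : rotSum (rot P) = rotSum P := by
  rw [rotSum_apply, rotSum_apply, rot_rot_rot hd hP]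
  ring

/-- The binary forms of degree `d` on which `flp` acts by `-1` and `rot` trivially. For even `d`
these are the forms that transform by the sign under the symmetric group generated by the two. -/
def altForms (d : ℕ) : Submodule ℚ (MvPolynomial (Fin 2) ℚ) :=
  binaryForms d ⊓ LinearMap.eqLocus flp.toLinearMap (-LinearMap.id) ⊓
    LinearMap.eqLocus rot.toLinearMap LinearMap.id

lemma mem_altForms : P ∈ altForms d ↔ P ∈ binaryForms d ∧ flp P = -P ∧ rot P = P := by
  simp [altForms, and_assoc]

instance (d : ℕ) : FiniteDimensional ℚ (altForms d) :=
  Submodule.finiteDimensional_of_le (inf_le_left.trans inf_le_left : altForms d ≤ binaryForms d)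

lemma rotSum_mem_altForms (hd : Even d) (hP : P ∈ binaryForms d) (h : flp P = -P) :
    rotSum P ∈ altForms d := by
  have hrot := rot_mem_binaryForms hP
  refine mem_altForms.2 ⟨add_mem (add_mem hP hrot) (rot_mem_binaryForms hrot), ?_, ?_⟩
  · rw [rotSum_apply, map_add, map_add, flp_rot hd hrot, flp_rot hd hP, h]
    simp only [map_neg, rot_rot_rot hd hP]
    ring
  · rw [rotSum_apply, map_add, map_add, rot_rot_rot hd hP]
    ring

/-- Dehomogenization `P(x, y) ↦ P(1, t)` of binary forms. -/
def dehom : MvPolynomial (Fin 2) ℚ →ₐ[ℚ] Polynomial ℚ := aeval ![1, Polynomial.X]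

@[simp] lemma dehom_X_zero : dehom (X 0) = 1 := by simp [dehom]
@[simp] lemma dehom_X_one : dehom (X 1) = Polynomial.X := by simp [dehom]

lemma eval_dehom (P : MvPolynomial (Fin 2) ℚ) (t : ℚ) : (dehom P).eval t = eval ![1, t] P := by
  have h : (Polynomial.aeval t).comp dehom = aeval ![1, t] := by
    ext i; fin_cases i <;> simp
  simpa [Polynomial.aeval_def] using congr($h P)

lemma eq_sum_coeff_dehom (hP : P ∈ binaryForms d) :
    P = ∑ k ∈ Finset.range (d + 1), (dehom P).coeff k • (X 0 ^ (d - k) * X 1 ^ k) := by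
  have h := binaryForms_eqOn (f := LinearMap.id) (g := ∑ k ∈ Finset.range (d + 1),
    (Polynomial.lcoeff ℚ k ∘ₗ dehom.toLinearMap).smulRight (X 0 ^ (d - k) * X 1 ^ k)) ?_ hP
  · simpa using h
  rintro i j rfl
  simp [Polynomial.coeff_X_pow, show j < i + j + 1 by omega]

lemma degree_dehom_lt (hP : P ∈ binaryForms d) : (dehom P).degree < (d + 1 : ℕ) := by
  rw [eq_sum_coeff_dehom hP, map_sum]
  refine (Polynomial.degree_sum_le _ _).trans_lt ((Finset.sup_lt_iff (WithBot.bot_lt_coe _)).2 ?_)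
  intro k hk
  simp only [map_smul, map_mul, map_pow, dehom_X_zero, dehom_X_one, one_pow, one_mul]
  refine (Polynomial.degree_smul_le _ _).trans_lt ?_
  rw [Polynomial.degree_X_pow]
  exact_mod_cast Finset.mem_range.1 hk

lemma eval_flp (P : MvPolynomial (Fin 2) ℚ) (x y : ℚ) : eval ![x, y] (flp P) = eval ![y, x] P := by
  have h : (aeval ![x, y] : MvPolynomial (Fin 2) ℚ →ₐ[ℚ] ℚ).comp flp = aeval ![y, x] := by
    ext i; fin_cases i <;> simp
  exact congr($h P)

lemma eval_rot (P : MvPolynomial (Fin 2) ℚ) (x y : ℚ) :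
    eval ![x, y] (rot P) = eval ![x - y, x] P := by
  have h : (aeval ![x, y] : MvPolynomial (Fin 2) ℚ →ₐ[ℚ] ℚ).comp rot = aeval ![x - y, x] := by
    ext i; fin_cases i <;> simp
  exact congr($h P)

lemma eval_swap_of_mem_altForms (hP : P ∈ altForms d) (x y : ℚ) :
    eval ![y, x] P = -eval ![x, y] P := by
  rw [← eval_flp, (mem_altForms.1 hP).2.1, map_neg]

lemma eval_sub_of_mem_altForms (hP : P ∈ altForms d) (x y : ℚ) :
    eval ![x - y, x] P = eval ![x, y] P := by
  rw [← eval_rot, (mem_altForms.1 hP).2.2]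

lemma eval_dehom_of_mem_altForms (hP : P ∈ altForms d) {t : ℚ}
    (ht : t ∈ ({0, 1, -1, 2, 1 / 2} : Finset ℚ)) : (dehom P).eval t = 0 := by
  rw [eval_dehom]
  have eval_one_one := eval_swap_of_mem_altForms hP 1 1
  have eval_one_two := eval_swap_of_mem_altForms hP 2 1
  have eval_one_half := eval_swap_of_mem_altForms hP (1 / 2) 1
  have rot_one_zero := eval_sub_of_mem_altForms hP 1 0
  have rot_two_one := eval_sub_of_mem_altForms hP 2 1
  have rot_one_neg := eval_sub_of_mem_altForms hP 1 (-1)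
  have rot_one_half := eval_sub_of_mem_altForms hP 1 (1 / 2)
  norm_num at rot_one_zero rot_two_one rot_one_neg rot_one_half
  simp only [Finset.mem_insert, Finset.mem_singleton] at ht
  rcases ht with rfl | rfl | rfl | rfl | rfl <;> linarith

lemma altForms_eq_bot (hd : d < 5) : altForms d = ⊥ := by
  refine (Submodule.eq_bot_iff _).2 fun P hP => ?_
  have hforms := (mem_altForms.1 hP).1
  have hdehom : dehom P = 0 := by
    refine Polynomial.eq_zero_of_degree_lt_of_eval_finset_eq_zero {0, 1, -1, 2, 1 / 2} ?_
      fun t ht => eval_dehom_of_mem_altForms hP ht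
    refine (degree_dehom_lt hforms).trans_le ?_
    rw [show Finset.card ({0, 1, -1, 2, 1 / 2} : Finset ℚ) = 5 by norm_num]
    exact_mod_cast hd
  rw [eq_sum_coeff_dehom hforms]
  simp [hdehom]

lemma X_one_sq_dvd_of_mem_altForms (hP : P ∈ altForms d) (h : (dehom P).coeff 1 = 0) :
    X 1 ^ 2 ∣ P := by
  have h0 : (dehom P).coeff 0 = 0 := by
    rw [Polynomial.coeff_zero_eq_eval_zero, eval_dehom_of_mem_altForms hP (by simp)]
  rw [eq_sum_coeff_dehom (mem_altForms.1 hP).1]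
  refine Finset.dvd_sum fun k _ => ?_
  match k with
  | 0 => simp [h0]
  | 1 => simp [h]
  | k + 2 => exact dvd_smul_of_dvd _ ((pow_dvd_pow _ (Nat.le_add_left 2 k)).mul_left _)

/-- The discriminant form `(x y (x - y))²`. -/
def disc : MvPolynomial (Fin 2) ℚ := (X 0 * X 1 * (X 0 - X 1)) ^ 2

lemma rot_disc : rot disc = disc := by
  simp only [disc, map_pow, map_mul, map_sub, rot_X_zero, rot_X_one]; ring

lemma flp_disc : flp disc = disc := by
  simp only [disc, map_pow, map_mul, map_sub, flp_X_zero, flp_X_one]; ring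

lemma isHomogeneous_disc : disc.IsHomogeneous 6 :=
  (((isHomogeneous_X ℚ 0).mul (isHomogeneous_X ℚ 1)).mul
    ((isHomogeneous_X ℚ 0).sub (isHomogeneous_X ℚ 1))).pow 2

lemma disc_ne_zero : disc ≠ 0 := by
  intro h
  have := congrArg (eval ![2, 1]) h
  norm_num [disc] at this

lemma disc_dvd_of_mem_altForms (hP : P ∈ altForms d) (h : (dehom P).coeff 1 = 0) : disc ∣ P := by
  have hrot := (mem_altForms.1 hP).2.2
  have hy : X 1 ^ 2 ∣ P := X_one_sq_dvd_of_mem_altForms hP h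
  have hx : X 0 ^ 2 ∣ P := by simpa [hrot] using map_dvd rot hy
  have hxy : (X 0 - X 1) ^ 2 ∣ P := by simpa [hrot] using map_dvd rot hx
  have rel_x_y : IsRelPrime (X 0 : MvPolynomial (Fin 2) ℚ) (X 1) :=
    isRelPrime_X_of_eval_ne_zero ![0, 1] rfl (by simp)
  have rel_x_sub : IsRelPrime (X 0 : MvPolynomial (Fin 2) ℚ) (X 0 - X 1) :=
    isRelPrime_X_of_eval_ne_zero ![0, 1] rfl (by simp)
  have rel_y_sub : IsRelPrime (X 1 : MvPolynomial (Fin 2) ℚ) (X 0 - X 1) :=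
    isRelPrime_X_of_eval_ne_zero ![1, 0] rfl (by simp)
  rw [disc, mul_pow, mul_pow]
  exact (rel_x_sub.pow.mul_left rel_y_sub.pow).mul_dvd (rel_x_y.pow.mul_dvd hx hy) hxy

lemma disc_mul_mem_altForms_iff : disc * P ∈ altForms (6 + d) ↔ P ∈ altForms d := by
  rw [mem_altForms, mem_altForms, map_mul, map_mul, rot_disc, flp_disc, ← mul_neg,
    mul_right_inj' disc_ne_zero, mul_right_inj' disc_ne_zero]
  exact and_congr_left fun _ =>
    ⟨isHomogeneous_of_mul_left isHomogeneous_disc disc_ne_zero, isHomogeneous_disc.mul⟩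

lemma coeff_one_dehom_disc_mul (P : MvPolynomial (Fin 2) ℚ) : (dehom (disc * P)).coeff 1 = 0 := by
  have h : dehom (disc * P) = Polynomial.X ^ 2 * ((1 - Polynomial.X) ^ 2 * dehom P) := by
    simp only [disc, map_mul, map_pow, map_sub, dehom_X_zero, dehom_X_one]
    ring
  rw [h, Polynomial.coeff_X_pow_mul']
  simp

end

/-- An alternating form of degree `6 + 2 * m` in which `x^(5 + 2 * m) y` has nonzero coefficient:
the alternating sextic times a power of the invariant quadric. -/
def altForm (m : ℕ) : MvPolynomial (Fin 2) ℚ :=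
  X 0 * X 1 * (X 0 - X 1) * ((X 0 + X 1) * (2 * X 0 - X 1) * (X 0 - 2 * X 1)) *
    (X 0 ^ 2 - X 0 * X 1 + X 1 ^ 2) ^ m

lemma coeff_one_dehom_altForm (m : ℕ) : (dehom (altForm m)).coeff 1 = 2 := by
  have h : dehom (altForm m) =
      Polynomial.X * ((1 - Polynomial.X) *
        ((1 + Polynomial.X) * (2 - Polynomial.X) * (1 - 2 * Polynomial.X)) *
        (1 - Polynomial.X + Polynomial.X ^ 2) ^ m) := by
    simp only [altForm, map_mul, map_pow, map_sub, map_add, map_ofNat, dehom_X_zero, dehom_X_one]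
    ring
  rw [h, Polynomial.coeff_X_mul, Polynomial.coeff_zero_eq_eval_zero]
  simp

lemma altForm_mem_altForms (m : ℕ) : altForm m ∈ altForms (6 + 2 * m) := by
  refine mem_altForms.2 ⟨?_, ?_, ?_⟩
  · have x := isHomogeneous_X ℚ (0 : Fin 2)
    have y := isHomogeneous_X ℚ (1 : Fin 2)
    have two_x : (2 * X 0 : MvPolynomial (Fin 2) ℚ).IsHomogeneous 1 := x.C_mul 2
    have two_y : (2 * X 1 : MvPolynomial (Fin 2) ℚ).IsHomogeneous 1 := y.C_mul 2
    exact (((x.mul y).mul (x.sub y)).mul (((x.add y).mul (two_x.sub y)).mul (x.sub two_y))).mul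
      ((((x.pow 2).sub (x.mul y)).add (y.pow 2)).pow m)
  · simp only [altForm, map_pow, map_mul, map_sub, map_add, flp_X_zero, flp_X_one, map_ofNat]
    ring
  · simp only [altForm, map_pow, map_mul, map_sub, map_add, rot_X_zero, rot_X_one, map_ofNat]
    rw [show ((X 0 - X 1) ^ 2 - (X 0 - X 1) * X 0 + X 0 ^ 2 : MvPolynomial (Fin 2) ℚ) =
      X 0 ^ 2 - X 0 * X 1 + X 1 ^ 2 by ring]
    ring

lemma finrank_altForms_six_add (m : ℕ) :
    Module.finrank ℚ (altForms (6 + 2 * m)) = Module.finrank ℚ (altForms (2 * m)) + 1 := by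
  let slope : altForms (6 + 2 * m) →ₗ[ℚ] ℚ :=
    Polynomial.lcoeff ℚ 1 ∘ₗ dehom.toLinearMap ∘ₗ (altForms (6 + 2 * m)).subtype
  have hslope : LinearMap.range slope = ⊤ := by
    refine LinearMap.range_eq_top.2 (LinearMap.surjective_of_ne_zero fun h => ?_)
    have := congr($h ⟨altForm m, altForm_mem_altForms m⟩)
    simp [slope, coeff_one_dehom_altForm] at this
  let mulDisc : altForms (2 * m) →ₗ[ℚ] LinearMap.ker slope :=
    (((LinearMap.mulLeft ℚ disc).restrict fun _ => disc_mul_mem_altForms_iff.2).codRestrict _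
      fun P => coeff_one_dehom_disc_mul P.1)
  have hmulDisc : Function.Bijective mulDisc := by
    refine ⟨fun P Q h => Subtype.ext (mul_left_cancel₀ disc_ne_zero congr(($h).1.1)), ?_⟩
    rintro ⟨⟨P, hP⟩, hs⟩
    obtain ⟨Q, rfl⟩ := disc_dvd_of_mem_altForms hP hs
    exact ⟨⟨Q, disc_mul_mem_altForms_iff.1 hP⟩, rfl⟩
  rw [← slope.finrank_range_add_finrank_ker, hslope, finrank_top, Module.finrank_self,
    (LinearEquiv.ofBijective mulDisc hmulDisc).finrank_eq, add_comm]

lemma finrank_altForms (m : ℕ) : Module.finrank ℚ (altForms (2 * m)) = m / 3 := by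
  induction m using Nat.strong_induction_on with
  | _ m ih =>
    rcases lt_or_ge m 3 with hm | hm
    · rw [altForms_eq_bot (by omega), finrank_bot, Nat.div_eq_of_lt hm]
    · obtain ⟨k, rfl⟩ := Nat.exists_eq_add_of_le hm
      rw [mul_add, finrank_altForms_six_add, ih k (by omega), Nat.add_div_left k three_pos]

/-! ### Even period polynomials -/

/-- The letters of the totally odd words: odd numbers `≥ 3`. -/
def IsLetter (n : ℕ) : Prop := 3 ≤ n ∧ Odd n

lemma isLetter_succ_iff {i : ℕ} : IsLetter (i + 1) ↔ Even i ∧ 0 < i := by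
  rw [IsLetter, Nat.odd_add_one, Nat.not_odd_iff_even]
  constructor
  · rintro ⟨h, hi⟩
    exact ⟨hi, by omega⟩
  · rintro ⟨⟨k, rfl⟩, hi⟩
    exact ⟨by omega, k, rfl⟩

lemma mem_oddIndices {N r : ℕ} {m : Fin r → ℕ} :
    m ∈ oddIndices N r ↔ ∑ i, m i = N ∧ ∀ i, IsLetter (m i) := by
  simp only [oddIndices, Finset.mem_filter, Finset.Nat.mem_antidiagonalTuple, IsLetter]

lemma V_two_eq_span (N : ℕ) : V N 2 = Submodule.span ℚ {P | ∃ i j, IsLetter (i + 1) ∧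
    IsLetter (j + 1) ∧ i + 1 + (j + 1) = N ∧ P = X 0 ^ i * X 1 ^ j} := by
  refine congrArg (Submodule.span ℚ) (Set.ext fun P => ⟨?_, ?_⟩)
  · rintro ⟨⟨m, hm⟩, rfl⟩
    obtain ⟨hsum, hlet⟩ := mem_oddIndices.1 hm
    have hpred : ∀ i, m i - 1 + 1 = m i := fun i =>
      Nat.sub_add_cancel ((Nat.le_add_left 1 2).trans (hlet i).1)
    rw [Fin.sum_univ_two] at hsum
    refine ⟨m 0 - 1, m 1 - 1, ?_, ?_, ?_, ?_⟩
    · exact (hpred 0).symm ▸ hlet 0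
    · exact (hpred 1).symm ▸ hlet 1
    · rwa [hpred, hpred]
    · exact (monomial_fin_two (expo m) (1 : ℚ)).trans (one_smul ℚ _)
  · rintro ⟨i, j, hi, hj, rfl, rfl⟩
    refine ⟨⟨![i + 1, j + 1], mem_oddIndices.2 ⟨by simp, Fin.forall_fin_two.2 ⟨hi, hj⟩⟩⟩, ?_⟩
    exact (monomial_fin_two (expo _) (1 : ℚ)).trans (one_smul ℚ _)

lemma V_two_eqOn {M : Type*} [AddCommGroup M] [Module ℚ M] {N : ℕ}
    {f g : MvPolynomial (Fin 2) ℚ →ₗ[ℚ] M}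
    (h : ∀ i j, IsLetter (i + 1) → IsLetter (j + 1) → i + 1 + (j + 1) = N →
      f (X 0 ^ i * X 1 ^ j) = g (X 0 ^ i * X 1 ^ j))
    {P : MvPolynomial (Fin 2) ℚ} (hP : P ∈ V N 2) : f P = g P := by
  rw [V_two_eq_span] at hP
  refine LinearMap.eqOn_span ?_ hP
  rintro _ ⟨i, j, hi, hj, hij, rfl⟩
  exact h i j hi hj hij

lemma X_pow_mul_X_pow_mem_V_two {N i j : ℕ} (hi : IsLetter (i + 1)) (hj : IsLetter (j + 1))
    (hij : i + 1 + (j + 1) = N) : X 0 ^ i * X 1 ^ j ∈ V N 2 := by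
  rw [V_two_eq_span]
  exact Submodule.subset_span ⟨i, j, hi, hj, hij, rfl⟩

/-- The antisymmetric form `∑ k, c k • (x^(2k+2) y^(d-2k-2) - x^(d-2k-2) y^(2k+2))`; the bound on
`k` says that `2k + 2 < d - 2k - 2`. -/
def antiForm (d : ℕ) : (Fin ((d - 2) / 4) → ℚ) →ₗ[ℚ] MvPolynomial (Fin 2) ℚ :=
  Fintype.linearCombination ℚ fun k =>
    X 0 ^ (2 * (k : ℕ) + 2) * X 1 ^ (d - (2 * k + 2)) -
      X 0 ^ (d - (2 * k + 2)) * X 1 ^ (2 * (k : ℕ) + 2)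

section

variable {d i j : ℕ}

lemma sub_mem_range_antiForm (hi : IsLetter (i + 1)) (hj : IsLetter (j + 1)) (hij : i + j = d) :
    X 0 ^ i * X 1 ^ j - X 0 ^ j * X 1 ^ i ∈ LinearMap.range (antiForm d) := by
  wlog h : i < j generalizing i j
  · rcases (not_lt.1 h).eq_or_lt with rfl | hji
    · simp
    · rw [← neg_sub]
      exact neg_mem (this hj hi (by omega) hji)
  obtain ⟨⟨a, rfl⟩, ha⟩ := isLetter_succ_iff.1 hi
  obtain ⟨⟨b, rfl⟩, -⟩ := isLetter_succ_iff.1 hj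
  refine ⟨Pi.single ⟨a - 1, by omega⟩ 1, ?_⟩
  rw [antiForm, Fintype.linearCombination_apply_single, one_smul]
  dsimp only
  rw [show 2 * (a - 1) + 2 = a + a by omega, show d - (a + a) = b + b by omega]

lemma antiForm_mem_binaryForms (c : Fin ((d - 2) / 4) → ℚ) : antiForm d c ∈ binaryForms d := by
  rw [antiForm, Fintype.linearCombination_apply]
  refine Submodule.sum_mem _ fun k _ => Submodule.smul_mem _ _ (sub_mem ?_ ?_) <;>
    exact X_pow_mul_X_pow_mem_binaryForms (by omega)

lemma antiForm_mem_V_two (hd : Even d) (c : Fin ((d - 2) / 4) → ℚ) :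
    antiForm d c ∈ V (d + 2) 2 := by
  rw [antiForm, Fintype.linearCombination_apply]
  refine Submodule.sum_mem _ fun k _ => Submodule.smul_mem _ _ ?_
  have h_left : IsLetter (2 * k + 2 + 1) := ⟨by omega, k + 1, by ring⟩
  have h_right : IsLetter (d - (2 * k + 2) + 1) :=
    isLetter_succ_iff.2 ⟨(Nat.even_sub (by omega)).2 (by simp [hd, parity_simps]), by omega⟩
  exact sub_mem (X_pow_mul_X_pow_mem_V_two h_left h_right (by omega))
    (X_pow_mul_X_pow_mem_V_two h_right h_left (by omega))

lemma flp_antiForm (c : Fin ((d - 2) / 4) → ℚ) : flp (antiForm d c) = -antiForm d c := by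
  rw [antiForm, Fintype.linearCombination_apply, map_sum, ← Finset.sum_neg_distrib]
  refine Finset.sum_congr rfl fun k _ => ?_
  rw [map_smul, ← smul_neg]
  simp only [map_sub, map_mul, map_pow, flp_X_zero, flp_X_one]
  ring_nf

lemma antiForm_injective (d : ℕ) : Function.Injective (antiForm d) := by
  refine (injective_iff_map_eq_zero _).2 fun c hc => funext fun k => ?_
  have h := congr((dehom $hc).coeff (2 * (k : ℕ) + 2))
  rw [antiForm, Fintype.linearCombination_apply, map_sum, Polynomial.finsetSum_coeff,
    Finset.sum_eq_single k] at h
  · have hne : 2 * (k : ℕ) + 2 ≠ d - (2 * k + 2) := by omega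
    simpa [Polynomial.coeff_X_pow, hne] using h
  · intro b _ hb
    have hbk : (k : ℕ) ≠ b := fun h => hb (Fin.ext h.symm)
    have hne : 2 * (k : ℕ) + 2 ≠ d - (2 * b + 2) := by omega
    simp [Polynomial.coeff_X_pow, hne, hbk]
  · simp

lemma rotSum_pow_sub_pow (hd : Even d) : rotSum (X 0 ^ d - X 1 ^ d) = 0 := by
  simp only [rotSum_apply, map_sub, map_pow, rot_X_zero, rot_X_one]
  rw [show (X 0 - X 1 - X 0 : MvPolynomial (Fin 2) ℚ) = -X 1 by ring, hd.neg_pow]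
  ring

lemma rotSum_sub_mem_range (hi : Even i) (hj : Even j) (hij : i + j = d) :
    rotSum (X 0 ^ i * X 1 ^ j - X 0 ^ j * X 1 ^ i) ∈ LinearMap.range (rotSum ∘ₗ antiForm d) := by
  rcases Nat.eq_zero_or_pos i with rfl | hi0
  · rw [pow_zero, pow_zero, one_mul, mul_one, ← neg_sub, map_neg, rotSum_pow_sub_pow hj, neg_zero]
    exact zero_mem _
  rcases Nat.eq_zero_or_pos j with rfl | hj0
  · rw [pow_zero, pow_zero, one_mul, mul_one, rotSum_pow_sub_pow hi]
    exact zero_mem _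
  obtain ⟨c, hc⟩ :=
    sub_mem_range_antiForm (isLetter_succ_iff.2 ⟨hi, hi0⟩) (isLetter_succ_iff.2 ⟨hj, hj0⟩) hij
  exact ⟨c, by rw [LinearMap.comp_apply, hc]⟩

end

lemma pow_mul_sub_pow_succ {R : Type*} [CommRing R] (x y : R) (i j : ℕ) :
    x ^ i * (y - x) ^ (j + 1) = x ^ i * y ^ (j + 1) - (j + 1) • (x ^ (i + 1) * y ^ j) +
      ∑ m ∈ Finset.range j,
        ((-1) ^ (j + 1 - m) * ((j + 1).choose m : ℤ)) • (x ^ (i + (j + 1 - m)) * y ^ m) := by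
  have hterm : ∀ m ∈ Finset.range j,
      x ^ i * (y ^ m * (-x) ^ (j + 1 - m) * ((j + 1).choose m : R)) =
        ((-1) ^ (j + 1 - m) * ((j + 1).choose m : ℤ)) • (x ^ (i + (j + 1 - m)) * y ^ m) := by
    intro m _
    rw [neg_pow x, zsmul_eq_mul, pow_add]
    push_cast
    ring
  rw [sub_eq_add_neg y, add_pow, Finset.sum_range_succ, Finset.sum_range_succ, mul_add, mul_add,
    Finset.mul_sum, Finset.sum_congr rfl hterm, nsmul_eq_mul]
  simp only [Nat.choose_self, Nat.choose_succ_self_right, Nat.add_sub_cancel_left, Nat.sub_self]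
  push_cast
  ring

section

variable {M : Type*} [AddCommGroup M] [Module ℚ M] {d : ℕ} {P : MvPolynomial (Fin 2) ℚ}

lemma eq_zero_of_shift_invariant (hd : Even d) {l : MvPolynomial (Fin 2) ℚ →ₗ[ℚ] M}
    (h_shift : ∀ i j, i + j = d → l (X 0 ^ i * (X 1 - X 0) ^ j) = l (X 0 ^ i * X 1 ^ j))
    (h_even : ∀ i j, i + j = d → Even i → Even j → l (X 0 ^ i * X 1 ^ j) = 0)
    (hP : P ∈ binaryForms d) : l P = 0 := by
  refine binaryForms_eqOn (g := 0) (fun i j => ?_) hP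
  induction j using Nat.strong_induction_on generalizing i with
  | _ j ih =>
    intro hij
    match i with
    | 0 => exact h_even 0 j hij Even.zero (by rwa [← hij, zero_add] at hd)
    | i + 1 =>
      have h := h_shift i (j + 1) (by omega)
      have hlower : ∀ m ∈ Finset.range j, l (((-1) ^ (j + 1 - m) * ((j + 1).choose m : ℤ)) •
          (X 0 ^ (i + (j + 1 - m)) * X 1 ^ m)) = 0 := fun m hm => by
        have hm := Finset.mem_range.1 hm
        rw [map_zsmul, ih m hm _ (by omega), LinearMap.zero_apply, smul_zero]
      rw [pow_mul_sub_pow_succ, map_add, map_sub, map_nsmul, map_sum, Finset.sum_eq_zero hlower,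
        add_zero, sub_eq_self, ← Nat.cast_smul_eq_nsmul ℚ, smul_eq_zero] at h
      exact h.resolve_left (Nat.cast_ne_zero.2 j.succ_ne_zero)

lemma shift_eq_smul_rot_flp (i j : ℕ) :
    X 0 ^ i * (X 1 - X 0) ^ j = (-1 : ℚ) ^ j • rot (flp (X 0 ^ i * X 1 ^ j)) := by
  simp only [map_mul, map_pow, flp_X_zero, flp_X_one, rot_X_zero, rot_X_one, smul_eq_C_mul, map_neg,
    map_one]
  rw [← neg_sub (X 0), neg_pow (X 0 - X 1)]
  ring

lemma eq_zero_of_rot_of_flp (hd : Even d) {l : MvPolynomial (Fin 2) ℚ →ₗ[ℚ] M}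
    (h_flp : ∀ P, l (flp P) = -l P) (h_rot : ∀ P ∈ binaryForms d, l (rot P) = l P)
    (h_even : ∀ i j, i + j = d → Even i → Even j → l (X 0 ^ i * X 1 ^ j) = 0)
    (hP : P ∈ binaryForms d) : l P = 0 := by
  refine eq_zero_of_shift_invariant hd (fun i j hij => ?_) h_even hP
  rw [shift_eq_smul_rot_flp, map_smul,
    h_rot _ (flp_mem_binaryForms (X_pow_mul_X_pow_mem_binaryForms hij)), h_flp]
  rcases Nat.even_or_odd j with hj | hj
  · rw [h_even i j hij ((Nat.even_add.1 (hij ▸ hd)).2 hj) hj, neg_zero, smul_zero]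
  · rw [hj.neg_one_pow, neg_one_smul, neg_neg]

lemma altForms_le_range (hd : Even d) :
    altForms d ≤ LinearMap.range (rotSum ∘ₗ antiForm d) := by
  intro P hP
  obtain ⟨hforms, hflp, hrot⟩ := mem_altForms.1 hP
  -- On alternating forms `l` is `6` times the quotient map, so it is enough that `l` vanishes.
  let l := (LinearMap.range (rotSum ∘ₗ antiForm d)).mkQ ∘ₗ rotSum ∘ₗ
    (LinearMap.id - flp.toLinearMap)
  have l_flp : ∀ Q, l (flp Q) = -l Q := fun Q => by
    simp only [l, LinearMap.comp_apply, LinearMap.sub_apply, LinearMap.id_apply,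
      AlgHom.toLinearMap_apply, flp_flp, ← map_neg, neg_sub]
  have l_rot : ∀ Q ∈ binaryForms d, l (rot Q) = l Q := fun Q hQ => by
    simp only [l, LinearMap.comp_apply, LinearMap.sub_apply, LinearMap.id_apply,
      AlgHom.toLinearMap_apply, map_sub, flp_rot hd hQ, rotSum_rot hd hQ,
      rotSum_rot hd (rot_mem_binaryForms (flp_mem_binaryForms hQ)),
      rotSum_rot hd (flp_mem_binaryForms hQ)]
  have l_even : ∀ i j, i + j = d → Even i → Even j → l (X 0 ^ i * X 1 ^ j) = 0 := by
    intro i j hij hi hj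
    refine (Submodule.Quotient.mk_eq_zero _).2 ?_
    simpa [mul_comm] using rotSum_sub_mem_range hi hj hij
  have l_P : l P = (LinearMap.range (rotSum ∘ₗ antiForm d)).mkQ ((6 : ℚ) • P) := by
    have h_sum : rotSum (P - flp P) = (6 : ℚ) • P := by
      simp only [rotSum_apply, hflp, map_sub, map_neg, hrot]
      module
    exact congrArg _ h_sum
  have six_smul_mem := (Submodule.Quotient.mk_eq_zero _).1
    (l_P.symm.trans (eq_zero_of_rot_of_flp hd l_flp l_rot l_even hforms))
  exact (Submodule.smul_mem_iff _ (by norm_num)).1 six_smul_mem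

lemma range_rotSum_antiForm (hd : Even d) :
    LinearMap.range (rotSum ∘ₗ antiForm d) = altForms d := by
  refine le_antisymm ?_ (altForms_le_range hd)
  rintro _ ⟨c, rfl⟩
  exact rotSum_mem_altForms hd (antiForm_mem_binaryForms c) (flp_antiForm c)

lemma finrank_ker_rotSum_antiForm (hd : Even d) :
    Module.finrank ℚ (LinearMap.ker (rotSum ∘ₗ antiForm d)) + d / 6 = (d - 2) / 4 := by
  have h := (rotSum ∘ₗ antiForm d).finrank_range_add_finrank_ker
  obtain ⟨m, rfl⟩ := even_iff_exists_two_mul.1 hd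
  rw [range_rotSum_antiForm hd, finrank_altForms, Module.finrank_fin_fun] at h
  omega

end

section

variable {N d : ℕ} {P : MvPolynomial (Fin 2) ℚ}

lemma substA_two_X_zero : substA 2 le_rfl (X 0) = X 1 - X 0 := by simp [substA]
lemma substA_two_X_one : substA 2 le_rfl (X 1) = X 1 := by simp [substA]
lemma substB_two_X_zero : substB 2 le_rfl (X 0) = X 1 - X 0 := by simp [substB]
lemma substB_two_X_one : substB 2 le_rfl (X 1) = X 0 := by simp [substB]

lemma substB_two_eq_rot (hP : P ∈ V N 2) : substB 2 le_rfl P = rot P := by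
  refine V_two_eqOn (f := (substB 2 le_rfl).toLinearMap) (g := rot.toLinearMap) ?_ hP
  intro i j hi _ _
  simp only [AlgHom.toLinearMap_apply, map_mul, map_pow, substB_two_X_zero, substB_two_X_one,
    rot_X_zero, rot_X_one]
  rw [← neg_sub, (isLetter_succ_iff.1 hi).1.neg_pow]

lemma substA_two_eq_flp_rot (hP : P ∈ V N 2) : substA 2 le_rfl P = flp (rot P) := by
  refine V_two_eqOn (f := (substA 2 le_rfl).toLinearMap)
    (g := flp.toLinearMap ∘ₗ rot.toLinearMap) ?_ hP
  intro i j _ _ _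
  simp only [LinearMap.comp_apply, AlgHom.toLinearMap_apply, map_mul, map_pow, substA_two_X_zero,
    substA_two_X_one, map_sub, flp_X_zero, flp_X_one, rot_X_zero, rot_X_one]

lemma mem_W {r : ℕ} {hr : 2 ≤ r} {P : MvPolynomial (Fin r) ℚ} :
    P ∈ W N r hr ↔ P ∈ V N r ∧ P = substA r hr P - substB r hr P := by
  simp [W]

lemma V_two_le_binaryForms (d : ℕ) : V (d + 2) 2 ≤ binaryForms d := by
  rw [V_two_eq_span, Submodule.span_le]
  rintro _ ⟨i, j, -, -, hij, rfl⟩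
  exact X_pow_mul_X_pow_mem_binaryForms (by omega)

lemma flp_eq_neg_of_mem_W_two (hP : P ∈ W N 2 le_rfl) : flp P = -P := by
  obtain ⟨hV, h⟩ := mem_W.1 hP
  rw [substA_two_eq_flp_rot hV, substB_two_eq_rot hV] at h
  conv_lhs => rw [h, map_sub, flp_flp]
  conv_rhs => rw [h, neg_sub]

lemma mem_W_two_iff (hd : Even d) :
    P ∈ W (d + 2) 2 le_rfl ↔ P ∈ V (d + 2) 2 ∧ flp P = -P ∧ rotSum P = 0 := by
  have key : P ∈ V (d + 2) 2 → flp P = -P → (P = substA 2 le_rfl P - substB 2 le_rfl P ↔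
      rotSum P = 0) := fun hV hflp => by
    rw [substA_two_eq_flp_rot hV, substB_two_eq_rot hV, flp_rot hd (V_two_le_binaryForms d hV),
      hflp, map_neg, map_neg, rotSum_apply]
    constructor <;> intro h <;> linear_combination h
  constructor
  · intro hP
    obtain ⟨hV, h⟩ := mem_W.1 hP
    have hflp := flp_eq_neg_of_mem_W_two hP
    exact ⟨hV, hflp, (key hV hflp).1 h⟩
  · rintro ⟨hV, hflp, hsum⟩
    exact mem_W.2 ⟨hV, (key hV hflp).2 hsum⟩

lemma mem_range_antiForm_of_flp_eq_neg (hV : P ∈ V (d + 2) 2) (hflp : flp P = -P) :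
    P ∈ LinearMap.range (antiForm d) := by
  have hle : V (d + 2) 2 ≤ (LinearMap.range (antiForm d)).comap
      (LinearMap.id - flp.toLinearMap) := by
    rw [V_two_eq_span, Submodule.span_le]
    rintro _ ⟨i, j, hi, hj, hij, rfl⟩
    simpa [mul_comm] using sub_mem_range_antiForm hi hj (by omega : i + j = d)
  have h2 : (2 : ℚ) • P ∈ LinearMap.range (antiForm d) := by
    simpa [hflp, two_smul] using hle hV
  exact (Submodule.smul_mem_iff _ two_ne_zero).1 h2

lemma W_two_eq_map (hd : Even d) :
    W (d + 2) 2 le_rfl = (LinearMap.ker (rotSum ∘ₗ antiForm d)).map (antiForm d) := by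
  ext P
  rw [mem_W_two_iff hd]
  constructor
  · rintro ⟨hV, hflp, hsum⟩
    obtain ⟨c, rfl⟩ := mem_range_antiForm_of_flp_eq_neg hV hflp
    exact ⟨c, hsum, rfl⟩
  · rintro ⟨c, hc, rfl⟩
    exact ⟨antiForm_mem_V_two hd c, flp_antiForm c, hc⟩

lemma finrank_W_two_add (hd : Even d) :
    Module.finrank ℚ (W (d + 2) 2 le_rfl) + d / 6 = (d - 2) / 4 := by
  rw [W_two_eq_map hd, ← (Submodule.equivMapOfInjective _ (antiForm_injective d) _).finrank_eq]
  exact finrank_ker_rotSum_antiForm hd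

lemma V_two_eq_bot (hN : ¬(Even N ∧ 2 ≤ N)) : V N 2 = ⊥ := by
  rw [V_two_eq_span, Submodule.span_eq_bot]
  rintro _ ⟨i, j, hi, hj, rfl, -⟩
  exact absurd ⟨hi.2.add_odd hj.2, by omega⟩ hN

/-- The dimension of the space of cusp forms of weight `N` for the modular group, as the number of
antisymmetric even forms of degree `N - 2` minus the dimension of the alternating ones. -/
def cuspDim (N : ℕ) : ℕ := if Even N then (N - 4) / 4 - (N - 2) / 6 else 0

lemma finrank_W_two (N : ℕ) : Module.finrank ℚ (W N 2 le_rfl) = cuspDim N := by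
  by_cases h : Even N ∧ 2 ≤ N
  · obtain ⟨d, rfl⟩ := Nat.exists_eq_add_of_le' h.2
    have := finrank_W_two_add (d := d) (by simpa [Nat.even_add] using h.1)
    rw [cuspDim, if_pos h.1]
    omega
  · have hW : W N 2 le_rfl = ⊥ := by rw [W, V_two_eq_bot h, bot_inf_eq]
    rw [hW, finrank_bot, cuspDim]
    split_ifs with hN <;> [skip; rfl]
    have : N < 2 := by by_contra! h2; exact h ⟨hN, h2⟩
    omega

end

/-! ### Words and the Ihara action of the first letter -/

/-- The free associative algebra on the letters `n ∈ ℕ`, as the space with basis all words. -/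
abbrev Words : Type := List ℕ →₀ ℚ

/-- Left multiplication by a letter in the free algebra. -/
def prepend (a : ℕ) : Words →ₗ[ℚ] Words := Finsupp.lmapDomain ℚ ℚ (List.cons a)

@[simp] lemma prepend_single (a : ℕ) (l : List ℕ) (c : ℚ) :
    prepend a (Finsupp.single l c) = Finsupp.single (a :: l) c := by
  simp [prepend]

instance : DecidablePred IsLetter := fun n => inferInstanceAs (Decidable (3 ≤ n ∧ Odd n))

section

variable {M M' : Type*} [AddCommGroup M] [Module ℚ M] [AddCommGroup M'] [Module ℚ M']

lemma words_ext {f g : Words →ₗ[ℚ] M}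
    (h : ∀ w, f (Finsupp.single w 1) = g (Finsupp.single w 1)) : f = g :=
  Finsupp.lhom_ext' fun w => LinearMap.ext_ring (h w)

lemma binary_linearMap_ext {f g : MvPolynomial (Fin 2) ℚ →ₗ[ℚ] M}
    (h : ∀ i j, f (X 0 ^ i * X 1 ^ j) = g (X 0 ^ i * X 1 ^ j)) : f = g := by
  refine (basisMonomials (Fin 2) ℚ).ext fun e => ?_
  simp only [coe_basisMonomials, monomial_fin_two, one_smul]
  exact h _ _

/-- The linear extension `∑ p(a, b) x^(a-1) y^(b-1) ↦ ∑ p(a, b) f(a, b)` of a function `f` of two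
letters; the shift of the exponents is that of `expo`. -/
def pairLift (f : ℕ → ℕ → M) : MvPolynomial (Fin 2) ℚ →ₗ[ℚ] M :=
  (basisMonomials (Fin 2) ℚ).constr ℚ fun e => f (e 0 + 1) (e 1 + 1)

lemma pairLift_X_pow (f : ℕ → ℕ → M) (i j : ℕ) :
    pairLift f (X 0 ^ i * X 1 ^ j) = f (i + 1) (j + 1) := by
  have h := (basisMonomials (Fin 2) ℚ).constr_basis ℚ (fun e => f (e 0 + 1) (e 1 + 1))
    (Finsupp.equivFunOnFinite.symm ![i, j])
  simp only [coe_basisMonomials, monomial_fin_two, one_smul] at h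
  simpa [pairLift] using h

lemma map_pairLift (g : M →ₗ[ℚ] M') (f : ℕ → ℕ → M) (P : MvPolynomial (Fin 2) ℚ) :
    g (pairLift f P) = pairLift (fun a b => g (f a b)) P := by
  have h : g ∘ₗ pairLift f = pairLift fun a b => g (f a b) :=
    binary_linearMap_ext fun i j => by rw [LinearMap.comp_apply, pairLift_X_pow, pairLift_X_pow]
  exact congr($h P)

lemma pairLift_apply (f : ℕ → ℕ → M →ₗ[ℚ] M') (P : MvPolynomial (Fin 2) ℚ) (w : M) :
    pairLift f P w = pairLift (fun a b => f a b w) P :=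
  map_pairLift (LinearMap.applyₗ w) f P

lemma pairLift_add (f g : ℕ → ℕ → M) (P : MvPolynomial (Fin 2) ℚ) :
    pairLift (fun a b => f a b + g a b) P = pairLift f P + pairLift g P := by
  have h : pairLift (fun a b => f a b + g a b) = pairLift f + pairLift g :=
    binary_linearMap_ext fun i j => by simp only [LinearMap.add_apply, pairLift_X_pow]
  exact congr($h P)

lemma pairLift_flp (f : ℕ → ℕ → M) (P : MvPolynomial (Fin 2) ℚ) :
    pairLift f (flp P) = pairLift (fun a b => f b a) P := by
  have h : pairLift f ∘ₗ flp.toLinearMap = pairLift fun a b => f b a :=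
    binary_linearMap_ext fun i j => by
      rw [LinearMap.comp_apply, AlgHom.toLinearMap_apply, map_mul, map_pow, map_pow, flp_X_zero,
        flp_X_one, mul_comm, pairLift_X_pow, pairLift_X_pow]
  exact congr($h P)

variable {N : ℕ} {P : MvPolynomial (Fin 2) ℚ}

lemma pairLift_congr {f g : ℕ → ℕ → M} (h : ∀ a b, IsLetter a → IsLetter b → f a b = g a b)
    (hP : P ∈ V N 2) : pairLift f P = pairLift g P := by
  refine V_two_eqOn (fun i j hi hj _ => ?_) hP
  rw [pairLift_X_pow, pairLift_X_pow, h _ _ hi hj]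

lemma pairLift_swap (hP : P ∈ W N 2 le_rfl) (f : ℕ → ℕ → M) :
    pairLift (fun a b => f b a) P = -pairLift f P := by
  rw [← pairLift_flp, flp_eq_neg_of_mem_W_two hP, map_neg]

lemma pairLift_eq_zero_of_symm (hP : P ∈ W N 2 le_rfl) {f : ℕ → ℕ → M}
    (hf : ∀ a b, f a b = f b a) : pairLift f P = 0 := by
  have h : pairLift f P = -pairLift f P :=
    (congr(pairLift $(funext₂ hf) P)).trans (pairLift_swap hP f)
  have h2 : (2 : ℚ) • pairLift f P = 0 := by rw [two_smul, ← eq_neg_iff_add_eq_zero, ← h]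
  exact (smul_eq_zero.1 h2).resolve_left two_ne_zero

end

/-- The linear map `x^(a-1) y^(b-1) ↦ (w ↦ a b w)`, where non-letters `a` or `b` give zero. -/
def prepend₂ : MvPolynomial (Fin 2) ℚ →ₗ[ℚ] Words →ₗ[ℚ] Words :=
  pairLift fun a b => if IsLetter a ∧ IsLetter b then prepend a ∘ₗ prepend b else 0

/-- The linear map `x^(a-1) y^(b-1) z^(c-1) ↦ (w ↦ a b c w)`, where non-letters give zero. -/
def prepend₃ : MvPolynomial (Fin 3) ℚ →ₗ[ℚ] Words →ₗ[ℚ] Words :=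
  (basisMonomials (Fin 3) ℚ).constr ℚ fun e =>
    if IsLetter (e 0 + 1) ∧ IsLetter (e 1 + 1) ∧ IsLetter (e 2 + 1) then
      prepend (e 0 + 1) ∘ₗ prepend (e 1 + 1) ∘ₗ prepend (e 2 + 1) else 0

lemma prepend₂_X_pow (i j : ℕ) : prepend₂ (X 0 ^ i * X 1 ^ j) =
    if IsLetter (i + 1) ∧ IsLetter (j + 1) then prepend (i + 1) ∘ₗ prepend (j + 1) else 0 :=
  pairLift_X_pow _ i j

lemma prepend₃_X_pow (i j k : ℕ) : prepend₃ (X 0 ^ i * X 1 ^ j * X 2 ^ k) =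
    if IsLetter (i + 1) ∧ IsLetter (j + 1) ∧ IsLetter (k + 1) then
      prepend (i + 1) ∘ₗ prepend (j + 1) ∘ₗ prepend (k + 1) else 0 := by
  have hmon : basisMonomials (Fin 3) ℚ (Finsupp.equivFunOnFinite.symm ![i, j, k]) =
      X 0 ^ i * X 1 ^ j * X 2 ^ k := by
    rw [coe_basisMonomials]
    dsimp only
    rw [monomial_eq, Finsupp.prod_fintype _ _ (by simp), Fin.prod_univ_three, C_1, one_mul]
    rfl
  rw [← hmon, prepend₃, Module.Basis.constr_basis]
  rfl

lemma prepend₂_eq_zero_of_odd {d : ℕ} (hd : Odd d) {P : MvPolynomial (Fin 2) ℚ}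
    (hP : P ∈ binaryForms d) : prepend₂ P = 0 := by
  refine binaryForms_eqOn (f := prepend₂) (g := 0) (fun i j hij => ?_) hP
  rw [prepend₂_X_pow, if_neg, LinearMap.zero_apply]
  rintro ⟨hi, hj⟩
  exact Nat.not_even_iff_odd.2 hd
    (hij ▸ (isLetter_succ_iff.1 hi).1.add (isLetter_succ_iff.1 hj).1)

lemma prepend₂_eq_pairLift {N : ℕ} {P : MvPolynomial (Fin 2) ℚ} (hP : P ∈ V N 2) (w : Words) :
    prepend₂ P w = pairLift (fun a b => prepend a (prepend b w)) P := by
  rw [prepend₂, pairLift_apply]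
  exact pairLift_congr (fun a b ha hb => by rw [if_pos ⟨ha, hb⟩, LinearMap.comp_apply]) hP

/-- The polynomial `(y - x)^(a-1) (x^(c-1) - y^(c-1))`, which describes the action of the letter `a`
on the letter `c`. -/
def pairPoly (a c : ℕ) : MvPolynomial (Fin 2) ℚ :=
  (X 1 - X 0) ^ (a - 1) * (X 0 ^ (c - 1) - X 1 ^ (c - 1))

/-- The action of the letter `a` on the first letter `c` of a word `c w`. -/
def pairAct (a c : ℕ) : Words →ₗ[ℚ] Words := prepend₂ (pairPoly a c)

lemma prepend₂_pairPoly (a c : ℕ) : prepend₂ (pairPoly a c) = pairAct a c := rfl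

/-- The action of the letter `a` on a word by the Leibniz rule. -/
def derWord (a : ℕ) : List ℕ → Words
  | [] => 0
  | c :: w => pairAct a c (Finsupp.single w 1) + prepend c (derWord a w)

/-- The derivation of the free algebra attached to the letter `a`. -/
def letterDer (a : ℕ) : Words →ₗ[ℚ] Words := Finsupp.linearCombination ℚ (derWord a)

lemma letterDer_single (a : ℕ) (w : List ℕ) :
    letterDer a (Finsupp.single w 1) = derWord a w := by
  simp [letterDer]

lemma letterDer_prepend (a c : ℕ) (w : Words) :
    letterDer a (prepend c w) = pairAct a c w + prepend c (letterDer a w) := by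
  have h : letterDer a ∘ₗ prepend c = pairAct a c + prepend c ∘ₗ letterDer a :=
    words_ext fun w => by
      simp only [LinearMap.comp_apply, prepend_single, letterDer_single, LinearMap.add_apply,
        derWord]
  exact congr($h w)

lemma pairPoly_mem_binaryForms (a c : ℕ) : pairPoly a c ∈ binaryForms (a - 1 + (c - 1)) := by
  have x := isHomogeneous_X ℚ (0 : Fin 2)
  have y := isHomogeneous_X ℚ (1 : Fin 2)
  simpa [pairPoly] using ((y.sub x).pow (a - 1)).mul ((x.pow (c - 1)).sub (y.pow (c - 1)))

lemma pairAct_eq_zero_of_not_isLetter {b k : ℕ} (hb : IsLetter b) (hk : ¬IsLetter (k + 1)) :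
    pairAct b (k + 1) = 0 := by
  rcases Nat.eq_zero_or_pos k with rfl | hk0
  · simp [pairAct, pairPoly]
  · have hk_odd : Odd k := by
      rw [isLetter_succ_iff] at hk
      exact Nat.not_even_iff_odd.1 fun h => hk ⟨h, hk0⟩
    exact prepend₂_eq_zero_of_odd ((Nat.Odd.sub_odd hb.2 odd_one).add_odd hk_odd)
      (pairPoly_mem_binaryForms b (k + 1))

/-- The action of the letter `b` on the words of length two, in terms of polynomials. -/
def derPoly (b : ℕ) : MvPolynomial (Fin 2) ℚ →ₗ[ℚ] MvPolynomial (Fin 3) ℚ :=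
  LinearMap.mulLeft ℚ ((X 1 - X 0) ^ (b - 1)) ∘ₗ
      ((rename ![0, 2]).toLinearMap - (rename ![1, 2]).toLinearMap) +
    LinearMap.mulLeft ℚ ((X 2 - X 1) ^ (b - 1)) ∘ₗ
      ((rename ![0, 1]).toLinearMap - (rename ![0, 2]).toLinearMap)

lemma derPoly_apply (b : ℕ) (P : MvPolynomial (Fin 2) ℚ) :
    derPoly b P = (X 1 - X 0) ^ (b - 1) * (rename ![0, 2] P - rename ![1, 2] P) +
      (X 2 - X 1) ^ (b - 1) * (rename ![0, 1] P - rename ![0, 2] P) := rfl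

lemma derPoly_X_pow (b i j : ℕ) : derPoly b (X 0 ^ i * X 1 ^ j) =
    rename ![0, 1] (pairPoly b (i + 1)) * X 2 ^ j +
      X 0 ^ i * rename ![1, 2] (pairPoly b (j + 1)) := by
  simp only [derPoly_apply, pairPoly, map_mul, map_pow, map_sub, rename_X, Matrix.cons_val_zero,
    Matrix.cons_val_one, Nat.add_sub_cancel]
  ring

lemma prepend₃_rename_mul_X_pow (P : MvPolynomial (Fin 2) ℚ) (k : ℕ) :
    prepend₃ (rename ![0, 1] P * X 2 ^ k) =
      if IsLetter (k + 1) then prepend₂ P ∘ₗ prepend (k + 1) else 0 := by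
  have h : prepend₃ ∘ₗ LinearMap.mulRight ℚ (X 2 ^ k) ∘ₗ (rename ![0, 1]).toLinearMap =
      if IsLetter (k + 1) then LinearMap.lcomp ℚ Words (prepend (k + 1)) ∘ₗ prepend₂ else 0 := by
    refine binary_linearMap_ext fun i j => ?_
    simp only [LinearMap.comp_apply, AlgHom.toLinearMap_apply, LinearMap.mulRight_apply, map_mul,
      map_pow, rename_X, Matrix.cons_val_zero, Matrix.cons_val_one, prepend₃_X_pow]
    by_cases hi : IsLetter (i + 1) <;> by_cases hj : IsLetter (j + 1) <;>
      by_cases hk : IsLetter (k + 1) <;> simp [prepend₂_X_pow, hi, hj, hk]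
    rfl
  refine (congr($h P)).trans ?_
  split_ifs <;> rfl

lemma prepend₃_X_pow_mul_rename (P : MvPolynomial (Fin 2) ℚ) (k : ℕ) :
    prepend₃ (X 0 ^ k * rename ![1, 2] P) =
      if IsLetter (k + 1) then prepend (k + 1) ∘ₗ prepend₂ P else 0 := by
  have h : prepend₃ ∘ₗ LinearMap.mulLeft ℚ (X 0 ^ k) ∘ₗ (rename ![1, 2]).toLinearMap =
      if IsLetter (k + 1) then LinearMap.compRight ℚ (prepend (k + 1)) ∘ₗ prepend₂ else 0 := by
    refine binary_linearMap_ext fun i j => ?_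
    simp only [LinearMap.comp_apply, AlgHom.toLinearMap_apply, LinearMap.mulLeft_apply, map_mul,
      map_pow, rename_X, Matrix.cons_val_zero, Matrix.cons_val_one, ← mul_assoc, prepend₃_X_pow]
    by_cases hi : IsLetter (i + 1) <;> by_cases hj : IsLetter (j + 1) <;>
      by_cases hk : IsLetter (k + 1) <;> simp [prepend₂_X_pow, hi, hj, hk]
  refine (congr($h P)).trans ?_
  split_ifs <;> rfl

lemma letterDer_prepend₂ {b : ℕ} (hb : IsLetter b) (P : MvPolynomial (Fin 2) ℚ) (w : Words) :
    letterDer b (prepend₂ P w) = prepend₃ (derPoly b P) w + prepend₂ P (letterDer b w) := by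
  have h : LinearMap.compRight ℚ (letterDer b) ∘ₗ prepend₂ =
      prepend₃ ∘ₗ derPoly b + LinearMap.lcomp ℚ Words (letterDer b) ∘ₗ prepend₂ := by
    refine binary_linearMap_ext fun i j => LinearMap.ext fun w => ?_
    simp only [LinearMap.add_apply, LinearMap.comp_apply, derPoly_X_pow, map_add,
      prepend₃_rename_mul_X_pow, prepend₃_X_pow_mul_rename, prepend₂_X_pow, prepend₂_pairPoly]
    by_cases hi : IsLetter (i + 1) <;> by_cases hj : IsLetter (j + 1)
    · simp [hi, hj, letterDer_prepend, add_assoc]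
    · simp [hi, hj, pairAct_eq_zero_of_not_isLetter hb hj]
    · simp [hi, hj, pairAct_eq_zero_of_not_isLetter hb hi]
    · simp [hi, hj]
  exact congr($h P w)

section

variable {N : ℕ} {P : MvPolynomial (Fin 2) ℚ}

lemma pairLift_pairPoly (hP : P ∈ W N 2 le_rfl) : pairLift pairPoly P = -P := by
  have h : pairLift pairPoly = (substB 2 le_rfl).toLinearMap - (substA 2 le_rfl).toLinearMap :=
    binary_linearMap_ext fun i j => by
      simp only [pairLift_X_pow, LinearMap.sub_apply, AlgHom.toLinearMap_apply, map_mul, map_pow,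
        substA_two_X_zero, substA_two_X_one, substB_two_X_zero, substB_two_X_one, pairPoly,
        Nat.add_sub_cancel]
      ring
  rw [h, LinearMap.sub_apply, ← neg_sub]
  exact congrArg Neg.neg (mem_W.1 hP).2.symm

lemma pairLift_pairAct (hP : P ∈ W N 2 le_rfl) (w : Words) :
    pairLift (fun a b => pairAct a b w) P = -prepend₂ P w := by
  simp only [← prepend₂_pairPoly]
  rw [← pairLift_apply, ← map_pairLift, pairLift_pairPoly hP, map_neg, LinearMap.neg_apply]

section

variable {A : Type*} [CommRing A] [Algebra ℚ A]

lemma aeval_eq_sub_of_mem_W_two (hP : P ∈ W N 2 le_rfl) (s t : A) :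
    aeval ![s, t] P = aeval ![t - s, t] P - aeval ![t - s, s] P := by
  have hA : (aeval ![s, t]).comp (substA 2 le_rfl) = aeval (R := ℚ) ![t - s, t] := by
    ext1 i; fin_cases i <;> simp [substA]
  have hB : (aeval ![s, t]).comp (substB 2 le_rfl) = aeval (R := ℚ) ![t - s, s] := by
    ext1 i; fin_cases i <;> simp [substB]
  conv_lhs => rw [(mem_W.1 hP).2]
  rw [map_sub, ← hA, ← hB]
  rfl

lemma aeval_swap (hP : P ∈ W N 2 le_rfl) (s t : A) : aeval ![t, s] P = -aeval ![s, t] P := by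
  have h : (aeval ![s, t]).comp flp = aeval (R := ℚ) ![t, s] := by
    ext1 i; fin_cases i <;> simp
  rw [← h, AlgHom.comp_apply, flp_eq_neg_of_mem_W_two hP, map_neg]

lemma pairLift_pow_mul_pow (s t c : A) (P : MvPolynomial (Fin 2) ℚ) :
    pairLift (fun a b => s ^ (a - 1) * t ^ (b - 1) * c) P = aeval ![s, t] P * c := by
  have h : pairLift (fun a b => s ^ (a - 1) * t ^ (b - 1) * c) =
      LinearMap.mulRight ℚ c ∘ₗ (aeval ![s, t]).toLinearMap :=
    binary_linearMap_ext fun i j => by simp [pairLift_X_pow]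
  exact congr($h P)

end

lemma pairLift_derPoly (hP : P ∈ W N 2 le_rfl) (c : ℕ) :
    pairLift (fun a b => derPoly b (pairPoly a c)) P = 0 := by
  have h_expand : (fun a b => derPoly b (pairPoly a c)) = fun a b : ℕ =>
      (X 2 - X 0 : MvPolynomial (Fin 3) ℚ) ^ (a - 1) * (X 1 - X 0) ^ (b - 1) *
        (X 0 ^ (c - 1) - X 2 ^ (c - 1)) +
      ((X 2 - X 1) ^ (a - 1) * (X 1 - X 0) ^ (b - 1) * (-(X 1 ^ (c - 1) - X 2 ^ (c - 1))) +
      ((X 1 - X 0) ^ (a - 1) * (X 2 - X 1) ^ (b - 1) * (X 0 ^ (c - 1) - X 1 ^ (c - 1)) +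
      (X 2 - X 0) ^ (a - 1) * (X 2 - X 1) ^ (b - 1) * (-(X 0 ^ (c - 1) - X 2 ^ (c - 1))))) := by
    funext a b
    simp only [derPoly_apply, pairPoly, map_mul, map_pow, map_sub, rename_X, Matrix.cons_val_zero,
      Matrix.cons_val_one]
    ring
  rw [h_expand]
  simp only [pairLift_add, pairLift_pow_mul_pow]
  have h_period := aeval_eq_sub_of_mem_W_two hP (X 1 - X 0 : MvPolynomial (Fin 3) ℚ) (X 2 - X 0)
  rw [sub_sub_sub_cancel_right, aeval_swap hP (X 2 - X 0) (X 1 - X 0),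
    aeval_swap hP (X 2 - X 0) (X 2 - X 1), aeval_swap hP (X 1 - X 0) (X 2 - X 1)] at h_period
  rw [aeval_swap hP (X 1 - X 0) (X 2 - X 1)]
  linear_combination (-(X 0 ^ (c - 1) - X 2 ^ (c - 1) : MvPolynomial (Fin 3) ℚ)) * h_period

lemma pairLift_letterDer_letterDer (hP : P ∈ W N 2 le_rfl) (w : Words) :
    pairLift (fun a b => letterDer b (letterDer a w)) P = 0 := by
  suffices h : pairLift (fun a b => letterDer b ∘ₗ letterDer a) P = 0 by
    have h_apply := pairLift_apply (fun a b => letterDer b ∘ₗ letterDer a) P w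
    rwa [h, LinearMap.zero_apply, eq_comm] at h_apply
  refine words_ext fun l => ?_
  rw [pairLift_apply, LinearMap.zero_apply]
  simp only [LinearMap.comp_apply]
  induction l with
  | nil => exact pairLift_eq_zero_of_symm hP fun a b => by simp [letterDer_single, derWord]
  | cons c l ih =>
    set w : Words := Finsupp.single l 1
    have h_leibniz : ∀ a b, IsLetter a → IsLetter b →
        letterDer b (letterDer a (prepend c w)) = prepend₃ (derPoly b (pairPoly a c)) w +
          ((pairAct a c (letterDer b w) + pairAct b c (letterDer a w)) +
            prepend c (letterDer b (letterDer a w))) := fun a b _ hb => by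
      rw [letterDer_prepend, map_add, ← prepend₂_pairPoly, letterDer_prepend₂ hb, letterDer_prepend]
      abel
    have h_head : pairLift (fun a b => prepend₃ (derPoly b (pairPoly a c)) w) P = 0 := by
      rw [← pairLift_apply, ← map_pairLift, pairLift_derPoly hP, map_zero, LinearMap.zero_apply]
    rw [← prepend_single, pairLift_congr h_leibniz (mem_W.1 hP).1, pairLift_add, pairLift_add,
      ← map_pairLift (prepend c), ih, map_zero, h_head,
      pairLift_eq_zero_of_symm hP fun a b => add_comm _ _, add_zero, add_zero]

end

/-- The Ihara action of the first letter of a word on the rest of it: `a w ↦ a ∘ w`. -/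
def act : Words →ₗ[ℚ] Words := Finsupp.linearCombination ℚ fun l : List ℕ =>
  match l with
  | [] => 0
  | a :: w => Finsupp.single (a :: w) 1 + derWord a w

/-- A linear map applied behind the first letter of each word. -/
def tailMap (f : Words →ₗ[ℚ] Words) : Words →ₗ[ℚ] Words :=
  Finsupp.linearCombination ℚ fun l : List ℕ =>
    match l with
    | [] => 0
    | a :: w => prepend a (f (Finsupp.single w 1))

lemma act_prepend (a : ℕ) (w : Words) : act (prepend a w) = prepend a w + letterDer a w := by
  have h : act ∘ₗ prepend a = prepend a + letterDer a :=
    words_ext fun w => by simp [act, letterDer_single]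
  exact congr($h w)

lemma tailMap_prepend (f : Words →ₗ[ℚ] Words) (a : ℕ) (w : Words) :
    tailMap f (prepend a w) = prepend a (f w) := by
  have h : tailMap f ∘ₗ prepend a = prepend a ∘ₗ f := words_ext fun w => by simp [tailMap]
  exact congr($h w)

section

variable {N : ℕ} {P : MvPolynomial (Fin 2) ℚ}

lemma act_prepend₂ (hP : P ∈ W N 2 le_rfl) (w : Words) :
    act (prepend₂ P w) = pairLift (fun a b => prepend b (letterDer a w)) P := by
  rw [prepend₂_eq_pairLift (mem_W.1 hP).1, map_pairLift]
  simp only [act_prepend, letterDer_prepend, pairLift_add]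
  rw [pairLift_pairAct hP, ← prepend₂_eq_pairLift (mem_W.1 hP).1]
  abel

lemma tailMap_act_prepend₂ (hP : P ∈ W N 2 le_rfl) (w : Words) :
    tailMap act (prepend₂ P w) =
      prepend₂ P w - pairLift (fun a b => prepend b (letterDer a w)) P := by
  rw [prepend₂_eq_pairLift (mem_W.1 hP).1, map_pairLift]
  simp only [tailMap_prepend, act_prepend, map_add, pairLift_add]
  rw [pairLift_swap hP (f := fun b a => prepend a (letterDer b w))]
  abel

lemma act_add_tailMap_act_prepend₂ (hP : P ∈ W N 2 le_rfl) (w : Words) :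
    act (prepend₂ P w) + tailMap act (prepend₂ P w) = prepend₂ P w := by
  rw [act_prepend₂ hP, tailMap_act_prepend₂ hP]
  abel

lemma act_tailMap_act_prepend₂ (hP : P ∈ W N 2 le_rfl) (w : Words) :
    act (tailMap act (prepend₂ P w)) = 0 := by
  rw [tailMap_act_prepend₂ hP, map_sub, act_prepend₂ hP, map_pairLift]
  simp only [act_prepend, pairLift_add]
  rw [pairLift_letterDer_letterDer hP]
  abel

end

/-! ### The matrix entries as coefficients of the action -/

lemma prepend_apply_cons (a : ℕ) (w : Words) (b : ℕ) (l : List ℕ) :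
    prepend a w (b :: l) = if a = b then w l else 0 := by
  rw [prepend, Finsupp.lmapDomain_apply]
  split_ifs with h
  · subst h
    exact Finsupp.mapDomain_apply (List.cons_injective (a := a)) w l
  · refine Finsupp.mapDomain_of_notMem_range _ _ ?_
    rintro ⟨l', hl'⟩
    exact h (List.cons_eq_cons.1 hl').1

lemma coeff_X_pow_mul_X_pow {R : Type*} [CommSemiring R] (i j a b : ℕ) :
    coeff (Finsupp.equivFunOnFinite.symm ![a, b]) (X 0 ^ i * X 1 ^ j : MvPolynomial (Fin 2) R) =
      if i = a ∧ j = b then 1 else 0 := by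
  simp [X_pow_eq_monomial, monomial_mul, coeff_monomial, DFunLike.ext_iff, Fin.forall_fin_two]

lemma prepend₂_apply_cons_cons {a b : ℕ} (ha : IsLetter a) (hb : IsLetter b)
    (P : MvPolynomial (Fin 2) ℚ) (w : Words) (l : List ℕ) : prepend₂ P w (a :: b :: l) =
      coeff (Finsupp.equivFunOnFinite.symm ![a - 1, b - 1]) P * w l := by
  have h : Finsupp.lapply (a :: b :: l) ∘ₗ LinearMap.applyₗ w ∘ₗ prepend₂ =
      LinearMap.mulRight ℚ (w l) ∘ₗ
        lcoeff ℚ (Finsupp.equivFunOnFinite.symm ![a - 1, b - 1]) := by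
    refine binary_linearMap_ext fun i j => ?_
    have hia : i = a - 1 ↔ i + 1 = a := by have := ha.1; omega
    have hjb : j = b - 1 ↔ j + 1 = b := by have := hb.1; omega
    simp only [LinearMap.comp_apply, prepend₂_X_pow, LinearMap.applyₗ_apply_apply,
      Finsupp.lapply_apply, lcoeff_apply, coeff_X_pow_mul_X_pow, LinearMap.mulRight_apply, hia, hjb]
    by_cases hij : i + 1 = a ∧ j + 1 = b
    · obtain ⟨rfl, rfl⟩ := hij
      simp [ha, hb, prepend_apply_cons]
    · rw [if_neg hij, zero_mul]
      split_ifs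
      · rw [LinearMap.comp_apply, prepend_apply_cons, prepend_apply_cons, ← ite_and, if_neg hij]
      · rfl
  exact congr($h P)

section

variable {R : Type*} [CommSemiring R] {s : ℕ}

lemma monomial_expo_succ (w : Fin (s + 1) → ℕ) :
    monomial (expo w) (1 : R) =
      X 0 ^ (w 0 - 1) * rename Fin.succ (monomial (expo fun i => w i.succ) 1) := by
  rw [monomial_eq, monomial_eq, Finsupp.prod_fintype _ _ (by simp),
    Finsupp.prod_fintype _ _ (by simp), Fin.prod_univ_succ]
  simp [expo]

lemma finSuccEquiv_rename_succ_eq_C (Q : MvPolynomial (Fin s) R) :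
    finSuccEquiv R s (rename Fin.succ Q) = Polynomial.C Q := by
  induction Q using MvPolynomial.induction_on with
  | C a => rw [rename_C, ← algebraMap_eq, AlgEquiv.commutes, ← algebraMap_eq]; rfl
  | add p q hp hq => rw [map_add, map_add, hp, hq, Polynomial.C_add]
  | mul_X p j hp =>
    rw [map_mul, map_mul, hp, rename_X, finSuccEquiv_X_succ, Polynomial.C_mul]

lemma coeff_X_pow_mul_rename_succ (k : ℕ) (Q : MvPolynomial (Fin s) R) (n : Fin (s + 1) → ℕ) :
    coeff (expo n) (X 0 ^ k * rename Fin.succ Q) =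
      if k = n 0 - 1 then coeff (expo fun i => n i.succ) Q else 0 := by
  have h_expo : expo n = (expo fun i => n i.succ).cons (n 0 - 1) :=
    Finsupp.ext fun i => Fin.cases rfl (fun _ => rfl) i
  rw [h_expo, ← finSuccEquiv_coeff_coeff, map_mul, map_pow, finSuccEquiv_X_zero,
    finSuccEquiv_rename_succ_eq_C, mul_comm, Polynomial.coeff_C_mul_X_pow]
  simp only [eq_comm (a := k)]
  split_ifs <;> simp

end

lemma expo_inj {s : ℕ} {m n : Fin s → ℕ} (hm : ∀ i, IsLetter (m i)) (hn : ∀ i, IsLetter (n i)) :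
    expo m = expo n ↔ m = n := by
  refine ⟨fun h => funext fun i => ?_, fun h => congrArg expo h⟩
  have hi : m i - 1 = n i - 1 := DFunLike.congr_fun h i
  have hmi := (hm i).1
  have hni := (hn i).1
  omega

lemma coeff_rename_mul_rename {s : ℕ} (P : MvPolynomial (Fin 2) ℚ) (Q : MvPolynomial (Fin s) ℚ)
    (n : Fin (s + 2) → ℕ) :
    coeff (expo n) (rename ![0, 1] P * rename Fin.succ (rename Fin.succ Q)) =
      coeff (Finsupp.equivFunOnFinite.symm ![n 0 - 1, n 1 - 1]) P *
        coeff (expo fun i => n i.succ.succ) Q := by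
  have h : lcoeff ℚ (expo n) ∘ₗ LinearMap.mulRight ℚ (rename Fin.succ (rename Fin.succ Q)) ∘ₗ
      (rename (![0, 1] : Fin 2 → Fin (s + 2))).toLinearMap =
      LinearMap.mulRight ℚ (coeff (expo fun i => n i.succ.succ) Q) ∘ₗ
        lcoeff ℚ (Finsupp.equivFunOnFinite.symm ![n 0 - 1, n 1 - 1]) := by
    refine binary_linearMap_ext fun i j => ?_
    have h_mul : rename ![0, 1] (X 0 ^ i * X 1 ^ j : MvPolynomial (Fin 2) ℚ) *
        rename Fin.succ (rename Fin.succ Q) =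
          X 0 ^ i * rename Fin.succ (X 0 ^ j * rename Fin.succ Q) := by
      simp [mul_assoc]
    simp only [LinearMap.comp_apply, AlgHom.toLinearMap_apply, LinearMap.mulRight_apply,
      lcoeff_apply, coeff_X_pow_mul_X_pow]
    rw [h_mul, coeff_X_pow_mul_rename_succ, coeff_X_pow_mul_rename_succ, ← ite_and, ite_mul,
      one_mul, zero_mul, Fin.succ_zero_eq_one]
  exact congr($h P)

/-- The summand of the Ihara action of `x^(a-1)` on `g` at the position `i`, for a letter `a`. -/
def iharaTerm {s : ℕ} (a : ℕ) (g : MvPolynomial (Fin s) ℚ) (i : Fin s) :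
    MvPolynomial (Fin (s + 1)) ℚ :=
  (X i.succ - X i.castSucc) ^ (a - 1) *
    (rename (Fin.succAbove i.succ) g - rename (Fin.succAbove i.castSucc) g)

section

variable {s a : ℕ}

lemma ihara_X_pow (ha : IsLetter a) (g : MvPolynomial (Fin s) ℚ) :
    ihara (Polynomial.X ^ (a - 1)) g =
      X 0 ^ (a - 1) * rename Fin.succ g + ∑ i, iharaTerm a g i := by
  have ha_even : Even (a - 1) := Nat.Odd.sub_odd ha.2 odd_one
  rw [ihara]
  simp only [map_pow, Polynomial.aeval_X, Polynomial.natDegree_X_pow, ha_even.neg_one_pow, one_mul]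
  refine congrArg _ (Finset.sum_congr rfl fun i _ => ?_)
  rw [iharaTerm, ← neg_sub (X i.succ) (X i.castSucc), ha_even.neg_pow]
  ring

lemma iharaTerm_zero (a : ℕ) (w : Fin (s + 1) → ℕ) :
    iharaTerm a (monomial (expo w) 1) 0 = rename ![0, 1] (pairPoly a (w 0)) *
      rename Fin.succ (rename Fin.succ (monomial (expo fun i => w i.succ) 1)) := by
  have h_comp : Fin.succAbove (1 : Fin (s + 2)) ∘ Fin.succ = Fin.succ ∘ Fin.succ := by
    funext i
    rw [Function.comp_apply, ← Fin.succ_zero_eq_one, Fin.succ_succAbove_succ]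
    simp
  rw [iharaTerm, monomial_expo_succ]
  simp only [map_mul, map_pow, rename_X, rename_rename, Fin.succ_zero_eq_one, Fin.castSucc_zero,
    h_comp, Fin.succAbove_zero, pairPoly, map_sub, Matrix.cons_val_zero, Matrix.cons_val_one,
    Fin.succAbove_of_castSucc_lt (1 : Fin (s + 2)) 0 Fin.zero_lt_one]
  ring

lemma iharaTerm_succ (a : ℕ) (w : Fin (s + 1) → ℕ) (i : Fin s) :
    iharaTerm a (monomial (expo w) 1) i.succ = X 0 ^ (w 0 - 1) *
      rename Fin.succ (iharaTerm a (monomial (expo fun i => w i.succ) 1) i) := by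
  have h_comp (j : Fin (s + 1)) :
      Fin.succAbove j.succ ∘ Fin.succ = Fin.succ ∘ Fin.succAbove j := by
    funext i
    simp [Fin.succ_succAbove_succ]
  rw [iharaTerm, iharaTerm, monomial_expo_succ]
  simp only [map_mul, map_pow, rename_X, rename_rename, Fin.castSucc_succ, h_comp, map_sub,
    Fin.succ_succAbove_zero]
  ring

lemma coeff_sum_iharaTerm (w : Fin s → ℕ) (n : Fin (s + 1) → ℕ) (hw : ∀ i, IsLetter (w i))
    (hn : ∀ i, IsLetter (n i)) :
    coeff (expo n) (∑ i, iharaTerm a (monomial (expo w) 1) i) =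
      derWord a (List.ofFn w) (List.ofFn n) := by
  induction s with
  | zero => simp [derWord]
  | succ s ih =>
    have h_sub_one : w 0 - 1 = n 0 - 1 ↔ w 0 = n 0 := by
      have hw0 := (hw 0).1
      have hn0 := (hn 0).1
      omega
    rw [Fin.sum_univ_succ, coeff_add, iharaTerm_zero, coeff_rename_mul_rename]
    simp only [iharaTerm_succ]
    rw [← Finset.mul_sum, ← map_sum, coeff_X_pow_mul_rename_succ,
      ih _ _ (fun i => hw i.succ) (fun i => hn i.succ), coeff_monomial,
      List.ofFn_succ (f := w), derWord, Finsupp.add_apply]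
    congr 1
    · rw [List.ofFn_succ (f := n), List.ofFn_succ, pairAct, prepend₂_apply_cons_cons (hn 0) (hn _),
        Finsupp.single_apply]
      simp only [expo_inj (fun i => hw i.succ) (fun i => hn i.succ.succ), List.ofFn_inj,
        Fin.succ_zero_eq_one]
    · rw [List.ofFn_succ (f := n), prepend_apply_cons]
      simp only [h_sub_one]

end

lemma act_single_cons (a : ℕ) (l : List ℕ) :
    act (Finsupp.single (a :: l) 1) = Finsupp.single (a :: l) 1 + derWord a l := by
  rw [← prepend_single, act_prepend, letterDer_single]

lemma e_eq_act_apply {r : ℕ} {m n : Fin r → ℕ} (hm : ∀ i, IsLetter (m i))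
    (hn : ∀ i, IsLetter (n i)) :
    e m n = act (Finsupp.single (List.ofFn m) 1) (List.ofFn n) := by
  cases r with
  | zero => simp [e, act]
  | succ s =>
    rw [e, ihara_X_pow (hm 0), coeff_add, coeff_sum_iharaTerm _ _ (fun i => hm i.succ) hn,
      ← monomial_expo_succ, List.ofFn_succ (f := m), act_single_cons, Finsupp.add_apply,
      coeff_monomial, Finsupp.single_apply, ← List.ofFn_succ (f := m)]
    simp only [List.ofFn_inj, expo_inj hm hn]

/-! ### Homogeneous components of the free algebra -/

/-- The words of weight `N` and depth `r` in odd letters `≥ 3`. -/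
def wordSet (N r : ℕ) : Set (List ℕ) := {l | l.length = r ∧ l.sum = N ∧ ∀ x ∈ l, IsLetter x}

/-- The homogeneous component of weight `N` and depth `r` of the free algebra on the odd
letters `≥ 3`. -/
def gradedPart (N r : ℕ) : Submodule ℚ Words := Finsupp.supported ℚ ℚ (wordSet N r)

section

variable {N r : ℕ}

lemma single_mem_gradedPart {l : List ℕ} (hl : l ∈ wordSet N r) (c : ℚ) :
    Finsupp.single l c ∈ gradedPart N r := Finsupp.single_mem_supported ℚ c hl

lemma cons_mem_wordSet {a : ℕ} {l : List ℕ} :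
    a :: l ∈ wordSet N (r + 1) ↔ IsLetter a ∧ ∃ M, a + M = N ∧ l ∈ wordSet M r := by
  simp only [wordSet, Set.mem_ofPred_eq, List.length_cons, Nat.add_right_cancel_iff, List.sum_cons,
    List.forall_mem_cons]
  constructor
  · rintro ⟨hlen, hsum, ha, hl⟩
    exact ⟨ha, _, hsum, hlen, rfl, hl⟩
  · rintro ⟨ha, M, hsum, hlen, rfl, hl⟩
    exact ⟨hlen, hsum, ha, hl⟩

lemma mem_wordSet_succ {l : List ℕ} : l ∈ wordSet N (r + 1) ↔
    ∃ a M l', IsLetter a ∧ l' ∈ wordSet M r ∧ a + M = N ∧ a :: l' = l := by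
  constructor
  · intro hl
    obtain ⟨a, l', rfl⟩ := List.exists_cons_of_length_eq_add_one hl.1
    obtain ⟨ha, M, hM, hl'⟩ := cons_mem_wordSet.1 hl
    exact ⟨a, M, l', ha, hl', hM, rfl⟩
  · rintro ⟨a, M, l', ha, hl', hM, rfl⟩
    exact cons_mem_wordSet.2 ⟨ha, M, hM, hl'⟩

lemma gradedPart_le {S : Submodule ℚ Words} (h : ∀ l ∈ wordSet N r, Finsupp.single l 1 ∈ S) :
    gradedPart N r ≤ S := by
  rw [gradedPart, Finsupp.supported_eq_span_single, Submodule.span_le]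
  rintro _ ⟨l, hl, rfl⟩
  exact h l hl

lemma gradedPart_eqOn {M : Type*} [AddCommGroup M] [Module ℚ M] {f g : Words →ₗ[ℚ] M}
    (h : ∀ l ∈ wordSet N r, f (Finsupp.single l 1) = g (Finsupp.single l 1))
    {z : Words} (hz : z ∈ gradedPart N r) : f z = g z :=
  gradedPart_le (S := LinearMap.eqLocus f g) h hz

lemma prepend_mem_gradedPart {a : ℕ} (ha : IsLetter a) {w : Words} (hw : w ∈ gradedPart N r) :
    prepend a w ∈ gradedPart (a + N) (r + 1) := by
  refine gradedPart_le (S := (gradedPart (a + N) (r + 1)).comap (prepend a)) (fun l hl => ?_) hw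
  rw [Submodule.mem_comap, prepend_single]
  exact single_mem_gradedPart (cons_mem_wordSet.2 ⟨ha, N, rfl, hl⟩) 1

lemma prepend₂_mem_gradedPart {d : ℕ} {P : MvPolynomial (Fin 2) ℚ} (hP : P ∈ binaryForms d)
    {w : Words} (hw : w ∈ gradedPart N r) : prepend₂ P w ∈ gradedPart (d + 2 + N) (r + 2) := by
  have h : binaryForms d ≤
      (gradedPart (d + 2 + N) (r + 2)).comap (LinearMap.applyₗ w ∘ₗ prepend₂) := by
    refine (binaryForms_le_span d).trans (Submodule.span_le.2 ?_)
    rintro _ ⟨i, j, rfl, rfl⟩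
    simp only [SetLike.mem_coe, Submodule.mem_comap, LinearMap.comp_apply, prepend₂_X_pow,
      LinearMap.applyₗ_apply_apply]
    split_ifs with hij
    · have := prepend_mem_gradedPart hij.1 (prepend_mem_gradedPart hij.2 hw)
      rwa [show i + 1 + (j + 1 + N) = i + j + 2 + N by ring] at this
    · exact zero_mem _
  exact h hP

lemma derWord_mem_gradedPart {a : ℕ} (ha : IsLetter a) {l : List ℕ} (hl : l ∈ wordSet N r) :
    derWord a l ∈ gradedPart (a + N) (r + 1) := by
  induction r generalizing N l with
  | zero =>
    rw [List.length_eq_zero_iff.1 hl.1, derWord]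
    exact zero_mem _
  | succ r ih =>
    obtain ⟨c, M, l, hc, hl', rfl, rfl⟩ := mem_wordSet_succ.1 hl
    have h_head := prepend₂_mem_gradedPart (pairPoly_mem_binaryForms a c)
      (single_mem_gradedPart hl' 1)
    have h_tail := prepend_mem_gradedPart hc (ih hl')
    have ha3 := ha.1
    have hc3 := hc.1
    rw [show a - 1 + (c - 1) + 2 + M = a + (c + M) by omega] at h_head
    rw [show c + (a + M) = a + (c + M) by ring] at h_tail
    exact add_mem h_head h_tail

end

/-- A linear map preserves weight and depth. -/
def IsGraded (f : Words →ₗ[ℚ] Words) : Prop :=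
  ∀ N r, ∀ z ∈ gradedPart N r, f z ∈ gradedPart N r

lemma isGraded_act : IsGraded act := by
  intro N r
  refine gradedPart_le (S := (gradedPart N r).comap act) fun l hl => ?_
  rw [Submodule.mem_comap]
  cases r with
  | zero =>
    rw [List.length_eq_zero_iff.1 hl.1]
    simp [act]
  | succ r =>
    obtain ⟨a, M, l', ha, hl', rfl, rfl⟩ := mem_wordSet_succ.1 hl
    rw [act_single_cons]
    exact add_mem (single_mem_gradedPart hl 1) (derWord_mem_gradedPart ha hl')

lemma isGraded_tailMap {f : Words →ₗ[ℚ] Words} (hf : IsGraded f) : IsGraded (tailMap f) := by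
  intro N r
  refine gradedPart_le (S := (gradedPart N r).comap (tailMap f)) fun l hl => ?_
  rw [Submodule.mem_comap]
  cases r with
  | zero =>
    rw [List.length_eq_zero_iff.1 hl.1]
    simp [tailMap]
  | succ r =>
    obtain ⟨a, M, l, ha, hl', rfl, rfl⟩ := mem_wordSet_succ.1 hl
    rw [← prepend_single, tailMap_prepend]
    exact prepend_mem_gradedPart ha (hf _ _ _ (single_mem_gradedPart hl' 1))

lemma isGraded_tailMap_iterate {f : Words →ₗ[ℚ] Words} (hf : IsGraded f) (k : ℕ) :
    IsGraded (tailMap^[k] f) := by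
  induction k with
  | zero => exact hf
  | succ k ih =>
    rw [Function.iterate_succ_apply']
    exact isGraded_tailMap ih

/-- The successive Ihara actions `a₁ a₂ ⋯ a_r ↦ a₁ ∘ (a₂ ∘ (⋯ ∘ a_r))` of all letters of a word. -/
def fullAct : Words →ₗ[ℚ] Words := Finsupp.linearCombination ℚ fun l : List ℕ =>
  l.foldr (fun a z => act (prepend a z)) (Finsupp.single [] 1)

lemma fullAct_nil : fullAct (Finsupp.single [] 1) = Finsupp.single [] 1 := by simp [fullAct]

lemma fullAct_prepend (a : ℕ) (w : Words) :
    fullAct (prepend a w) = act (prepend a (fullAct w)) := by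
  have h : fullAct ∘ₗ prepend a = act ∘ₗ prepend a ∘ₗ fullAct :=
    words_ext fun w => by simp [fullAct]
  exact congr($h w)

lemma fullAct_singleton (a : ℕ) :
    fullAct (Finsupp.single [a] 1) = Finsupp.single [a] 1 := by
  rw [← prepend_single, fullAct_prepend, fullAct_nil, act_prepend, letterDer_single, derWord,
    add_zero]

lemma isGraded_fullAct : IsGraded fullAct := by
  intro N r
  induction r generalizing N with
  | zero =>
    refine gradedPart_le (S := (gradedPart N 0).comap fullAct) fun l hl => ?_
    obtain rfl := List.length_eq_zero_iff.1 hl.1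
    rw [Submodule.mem_comap, fullAct_nil]
    exact single_mem_gradedPart hl 1
  | succ r ih =>
    refine gradedPart_le (S := (gradedPart N (r + 1)).comap fullAct) fun l hl => ?_
    obtain ⟨a, M, l, ha, hl', rfl, rfl⟩ := mem_wordSet_succ.1 hl
    rw [Submodule.mem_comap, ← prepend_single, fullAct_prepend]
    exact isGraded_act _ _ _ (prepend_mem_gradedPart ha (ih _ _ (single_mem_gradedPart hl' 1)))

lemma tailMap_iterate_apply (f : Words →ₗ[ℚ] Words) {k : ℕ} {l l' : List ℕ} (hl : k ≤ l.length)
    (hl' : k ≤ l'.length) : (tailMap^[k] f) (Finsupp.single l 1) l' =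
      if l.take k = l'.take k then f (Finsupp.single (l.drop k) 1) (l'.drop k) else 0 := by
  induction k generalizing l l' with
  | zero => simp
  | succ k ih =>
    match l, l', hl, hl' with
    | a :: l, b :: l', hl, hl' =>
      rw [Function.iterate_succ_apply', ← prepend_single, tailMap_prepend, prepend_apply_cons,
        ih (Nat.le_of_succ_le_succ hl) (Nat.le_of_succ_le_succ hl')]
      by_cases hab : a = b <;> simp [hab]

lemma tailMap_iterate_fullAct_single {k : ℕ} {l : List ℕ} (hl : l.length = k + 1) :
    (tailMap^[k] fullAct) (Finsupp.single l 1) = Finsupp.single l 1 := by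
  induction k generalizing l with
  | zero =>
    obtain ⟨a, rfl⟩ := List.length_eq_one_iff.1 hl
    exact fullAct_singleton a
  | succ k ih =>
    obtain ⟨a, l, rfl⟩ := List.exists_cons_of_length_eq_add_one hl
    rw [Function.iterate_succ_apply', ← prepend_single, tailMap_prepend, ih (Nat.succ.inj hl)]

lemma tailMap_iterate_act_comp_fullAct {N r k : ℕ} (hk : k < r) {z : Words}
    (hz : z ∈ gradedPart N r) :
    (tailMap^[k] act) ((tailMap^[k + 1] fullAct) z) = (tailMap^[k] fullAct) z := by
  refine gradedPart_eqOn (f := tailMap^[k] act ∘ₗ tailMap^[k + 1] fullAct) (fun l hl => ?_) hz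
  rw [← hl.1] at hk
  clear hl hz
  rw [LinearMap.comp_apply]
  induction k generalizing l with
  | zero =>
    obtain ⟨a, l, rfl⟩ := List.exists_cons_of_length_pos hk
    rw [← prepend_single]
    exact (congrArg act (tailMap_prepend fullAct a _)).trans (fullAct_prepend a _).symm
  | succ k ih =>
    obtain ⟨a, l, rfl⟩ := List.exists_cons_of_length_pos (k.succ_pos.trans hk)
    rw [Function.iterate_succ_apply' _ (k + 1) fullAct, ← prepend_single, tailMap_prepend,
      Function.iterate_succ_apply' _ k act, tailMap_prepend, ih l (Nat.lt_of_succ_lt_succ hk),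
      Function.iterate_succ_apply' _ k fullAct, tailMap_prepend]

lemma fullAct_eq_act_tailMap {N r : ℕ} {z : Words} (hz : z ∈ gradedPart N (r + 1)) :
    fullAct z = act (tailMap fullAct z) :=
  (tailMap_iterate_act_comp_fullAct r.succ_pos hz).symm

/-! ### Coefficient vectors as elements of the free algebra -/

lemma ofFn_mem_wordSet {N r : ℕ} {m : Fin r → ℕ} :
    List.ofFn m ∈ wordSet N r ↔ m ∈ oddIndices N r := by
  simp [wordSet, mem_oddIndices, List.sum_ofFn]

/-- The multi-indices of `S_{N,r}` as words of weight `N` and depth `r`. -/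
def idxEquivWordSet (N r : ℕ) : Idx N r ≃ wordSet N r where
  toFun m := ⟨List.ofFn m.1, ofFn_mem_wordSet.2 m.2⟩
  invFun l := ⟨fun i => l.1.get (i.cast l.2.1.symm), ofFn_mem_wordSet.1 <| by
    rw [← List.ofFn_congr l.2.1 l.1.get, List.ofFn_get]
    exact l.2⟩
  left_inv m := Subtype.ext <| funext fun i => by simp
  right_inv l := Subtype.ext <| (List.ofFn_congr l.2.1 l.1.get).symm.trans (List.ofFn_get l.1)

instance (N r : ℕ) : Finite (wordSet N r) := .of_equiv _ (idxEquivWordSet N r)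

/-- The coefficients of an element of a homogeneous component. -/
def gradedPartEquiv (N r : ℕ) : gradedPart N r ≃ₗ[ℚ] (wordSet N r → ℚ) :=
  Finsupp.supportedEquivFinsupp (wordSet N r) ≪≫ₗ Finsupp.linearEquivFunOnFinite ℚ ℚ (wordSet N r)

/-- A vector indexed by `S_{N,r}` as the linear combination of words with these coefficients. -/
def toWords (N r : ℕ) : (Idx N r → ℚ) ≃ₗ[ℚ] gradedPart N r :=
  LinearEquiv.funCongrLeft ℚ ℚ (idxEquivWordSet N r).symm ≪≫ₗ (gradedPartEquiv N r).symm

section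

variable {N r : ℕ}

lemma toWords_symm_apply (z : gradedPart N r) (n : Idx N r) :
    (toWords N r).symm z n = (z : Words) (List.ofFn n.1) := rfl

lemma toWords_coe (u : Idx N r → ℚ) :
    (toWords N r u : Words) = ∑ m : Idx N r, u m • Finsupp.single (List.ofFn m.1) 1 := by
  have h_mem : ∑ m : Idx N r, u m • Finsupp.single (List.ofFn m.1) 1 ∈ gradedPart N r :=
    Submodule.sum_mem _ fun m _ => Submodule.smul_mem _ _
      (single_mem_gradedPart (ofFn_mem_wordSet.2 m.2) 1)
  suffices h : toWords N r u = ⟨_, h_mem⟩ from congrArg Subtype.val h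
  rw [← LinearEquiv.eq_symm_apply]
  funext n
  rw [toWords_symm_apply, Finsupp.finsetSum_apply]
  simp [Finsupp.single_apply, List.ofFn_inj, Subtype.ext_iff.symm]

variable {A : Matrix (Idx N r) (Idx N r) ℚ} {f : Words →ₗ[ℚ] Words}

lemma toWords_vecMul (hf : IsGraded f)
    (h : ∀ m n : Idx N r, A m n = f (Finsupp.single (List.ofFn m.1) 1) (List.ofFn n.1))
    (u : Idx N r → ℚ) : (toWords N r (Matrix.vecMul u A) : Words) = f (toWords N r u) := by
  suffices h' : toWords N r (Matrix.vecMul u A) = ⟨_, hf _ _ _ (toWords N r u).2⟩ from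
    congrArg Subtype.val h'
  rw [← LinearEquiv.eq_symm_apply]
  funext n
  change _ = f (toWords N r u) (List.ofFn n.1)
  rw [toWords_coe, map_sum, Finsupp.finsetSum_apply]
  simp only [map_smul, Finsupp.smul_apply, ← h, Matrix.vecMul, dotProduct, smul_eq_mul]

lemma toWords_vecMul_E (u : Idx N r → ℚ) :
    (toWords N r (Matrix.vecMul u (E N r)) : Words) = act (toWords N r u) :=
  toWords_vecMul isGraded_act (fun m n => e_eq_act_apply (mem_oddIndices.1 m.2).2
    (mem_oddIndices.1 n.2).2) u

end

lemma ofFn_lastEntries {r j : ℕ} (h : j ≤ r) (m : Fin r → ℕ) :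
    List.ofFn (lastEntries h m) = (List.ofFn m).drop (r - j) :=
  List.ext_getElem (by simpa using (Nat.sub_sub_self h).symm) fun i _ _ => by simp [lastEntries]

lemma take_ofFn_eq_iff {α : Type*} {r k : ℕ} {m n : Fin r → α} :
    (List.ofFn m).take k = (List.ofFn n).take k ↔ ∀ i : Fin r, (i : ℕ) < k → m i = n i := by
  rw [List.ext_get_iff]
  simp only [List.length_take, List.length_ofFn, lt_inf_iff, List.get_eq_getElem,
    List.getElem_take, List.getElem_ofFn, forall_and_index, true_and, Fin.forall_iff]
  grind

lemma toWords_vecMul_Ej {N r j : ℕ} (hj : j ≤ r) (u : Idx N r → ℚ) :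
    (toWords N r (Matrix.vecMul u (Ej N r j)) : Words) =
      (tailMap^[r - j] act) (toWords N r u) := by
  refine toWords_vecMul (isGraded_tailMap_iterate isGraded_act _) (fun m n => ?_) u
  rw [tailMap_iterate_apply _ (by simp) (by simp), ← ofFn_lastEntries hj, ← ofFn_lastEntries hj]
  simp only [take_ofFn_eq_iff, Ej, Matrix.of_apply, dif_pos hj]
  congr 1
  exact e_eq_act_apply (fun i => (mem_oddIndices.1 m.2).2 _) (fun i => (mem_oddIndices.1 n.2).2 _)

lemma toWords_vecMul_prod_Ej {N r : ℕ} {k : ℕ} (hk : k + 2 ≤ r) (u : Idx N r → ℚ) :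
    (toWords N r (Matrix.vecMul u ((List.range' 2 k).map fun j => Ej N r j).prod) : Words) =
      (tailMap^[r - 1 - k] fullAct) (toWords N r u) := by
  induction k with
  | zero =>
    rw [List.range'_zero, List.map_nil, List.prod_nil, Matrix.vecMul_one, Nat.sub_zero]
    refine (gradedPart_eqOn (f := tailMap^[r - 1] fullAct) (g := LinearMap.id) (fun l hl => ?_)
      (toWords N r u).2).symm
    exact tailMap_iterate_fullAct_single (by rw [hl.1]; omega)
  | succ k ih =>
    rw [List.range'_concat, List.map_append, List.prod_append, List.map_singleton,
      List.prod_singleton, ← Matrix.vecMul_vecMul, toWords_vecMul_Ej (by omega), ih (by omega),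
      show r - 1 - k = r - 1 - (k + 1) + 1 by omega,
      show r - (2 + 1 * k) = r - 1 - (k + 1) by omega]
    exact tailMap_iterate_act_comp_fullAct (by omega) (toWords N r u).2

lemma toWords_vecMul_C {N r : ℕ} (hr : 2 ≤ r) (u : Idx N r → ℚ) :
    (toWords N r (Matrix.vecMul u (C N r)) : Words) = fullAct (toWords N r u) := by
  obtain ⟨s, rfl⟩ := Nat.exists_eq_add_of_le' hr
  rw [C, ← Matrix.vecMul_vecMul, toWords_vecMul_E, toWords_vecMul_prod_Ej (by omega),
    show s + 2 - 1 - (s + 2 - 2) = 1 by omega]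
  exact (fullAct_eq_act_tailMap (toWords N (s + 2) u).2).symm

/-! ### Tensor products of subspaces -/

section MatrixSubspace

variable {K I J : Type*} [Field K]

/-- The families of vectors `f i ∈ B` all of whose coordinates `i ↦ f i j` lie in `A`: the tensor
product `A ⊗ B` realised as the space of matrices with columns in `A` and rows in `B`. -/
def matSub (A : Submodule K (I → K)) (B : Submodule K (J → K)) : Submodule K (I → J → K) :=
  Submodule.pi Set.univ (fun _ => B) ⊓
    ⨅ j, A.comap (LinearMap.pi fun i => LinearMap.proj j ∘ₗ LinearMap.proj i)

variable {A : Submodule K (I → K)} {B : Submodule K (J → K)} {f : I → J → K}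

lemma mem_matSub : f ∈ matSub A B ↔ (∀ i, f i ∈ B) ∧ ∀ j, (fun i => f i j) ∈ A := by
  simp only [matSub, Submodule.mem_inf, Submodule.mem_pi, Set.mem_univ, forall_true_left,
    Submodule.mem_iInf, Submodule.mem_comap]
  rfl

lemma functional_apply_mem_of_col_mem [Finite J] (φ : (J → K) →ₗ[K] K)
    (hf : ∀ j, (fun i => f i j) ∈ A) : (fun i => φ (f i)) ∈ A := by
  classical
  have := Fintype.ofFinite J
  have h_sum : (fun i => φ (f i)) =
      ∑ j, φ (fun k => if j = k then 1 else 0) • fun i => f i j := by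
    funext i
    rw [LinearMap.pi_apply_eq_sum_univ φ (f i), Finset.sum_apply]
    exact Finset.sum_congr rfl fun j _ => mul_comm _ _
  rw [h_sum]
  exact A.sum_mem fun j _ => A.smul_mem _ (hf j)

lemma coord_mem_of_mem_matSub [Finite J] {ι : Type*} (b : Module.Basis ι K B)
    (hf : f ∈ matSub A B) (l : ι) : (fun i => b.repr ⟨f i, (mem_matSub.1 hf).1 i⟩ l) ∈ A := by
  obtain ⟨φ, hφ⟩ := LinearMap.exists_extend (b.coord l)
  convert functional_apply_mem_of_col_mem φ (mem_matSub.1 hf).2 using 2 with i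
  exact congr($hφ.symm ⟨f i, _⟩)

lemma sum_mul_basis_mem_matSub {ι : Type*} [Fintype ι] (b : Module.Basis ι K B) (h : ι → A) :
    (fun i j => ∑ l, (h l : I → K) i * (b l : J → K) j) ∈ matSub A B := by
  refine mem_matSub.2 ⟨fun i => ?_, fun j => ?_⟩
  · convert B.sum_mem fun l (_ : l ∈ Finset.univ) => B.smul_mem ((h l : I → K) i) (b l).2
    simp
  · convert A.sum_mem fun l (_ : l ∈ Finset.univ) => A.smul_mem ((b l : J → K) j) (h l).2
    simp [mul_comm]

/-- The coordinates with respect to a basis of `B` identify `A ⊗ B` with tuples of vectors in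
`A`. -/
def matSubEquiv [Finite J] {ι : Type*} [Fintype ι] (b : Module.Basis ι K B) :
    matSub A B ≃ₗ[K] (ι → A) where
  toFun f l := ⟨_, coord_mem_of_mem_matSub b f.2 l⟩
  invFun h := ⟨_, sum_mul_basis_mem_matSub b h⟩
  map_add' f g := by
    ext l i
    exact congr($(map_add b.repr ⟨f.1 i, _⟩ ⟨g.1 i, _⟩) l)
  map_smul' c f := by
    ext l i
    exact congr($(map_smul b.repr c ⟨f.1 i, _⟩) l)
  left_inv f := by
    ext i j
    have h := congr(($(b.sum_repr ⟨f.1 i, (mem_matSub.1 f.2).1 i⟩) : J → K) j)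
    rwa [AddSubmonoidClass.coe_finsetSum, Finset.sum_apply] at h
  right_inv h := by
    ext l i
    have h_sum : (⟨_, (mem_matSub.1 (sum_mul_basis_mem_matSub b h)).1 i⟩ : B) =
        ∑ l, (h l : I → K) i • b l := Subtype.ext <| funext fun j => by simp
    change b.repr ⟨_, _⟩ l = _
    rw [h_sum, b.repr_sum_self]

lemma finrank_matSub [Finite I] [Finite J] (A : Submodule K (I → K)) (B : Submodule K (J → K)) :
    Module.finrank K (matSub A B) = Module.finrank K A * Module.finrank K B := by
  rw [(matSubEquiv (Module.finBasis K B)).finrank_eq, Module.finrank_pi_fintype,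
    Finset.sum_const, Finset.card_fin, smul_eq_mul, mul_comm]

end MatrixSubspace

lemma finrank_comap_of_injective {K M M' : Type*} [Field K] [AddCommGroup M] [Module K M]
    [AddCommGroup M'] [Module K M'] {f : M →ₗ[K] M'} (hf : Function.Injective f)
    (A : Submodule K M') :
    Module.finrank K (A.comap f) = Module.finrank K (A ⊓ LinearMap.range f : Submodule K M') := by
  rw [(Submodule.equivMapOfInjective f hf _).finrank_eq, Submodule.map_comap_eq, inf_comm]

/-- The part of an element behind the initial word `x`. -/
def row (x : List ℕ) : Words →ₗ[ℚ] Words :=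
  Finsupp.lcomapDomain (x ++ ·) (List.append_right_injective x)

/-- The part of an element before the final word `y`. -/
def col (y : List ℕ) : Words →ₗ[ℚ] Words :=
  Finsupp.lcomapDomain (· ++ y) (List.append_left_injective y)

lemma row_apply (x : List ℕ) (z : Words) (l : List ℕ) : row x z l = z (x ++ l) := rfl

lemma col_apply (y : List ℕ) (z : Words) (l : List ℕ) : col y z l = z (l ++ y) := rfl

section

variable {a b i j N : ℕ}

lemma append_mem_wordSet_iff {x y : List ℕ} (hx : x ∈ wordSet i a) (hij : i + j = N) :
    x ++ y ∈ wordSet N (a + b) ↔ y ∈ wordSet j b := by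
  obtain ⟨rfl, rfl, hx⟩ := hx
  simp only [wordSet, Set.mem_ofPred_eq, List.length_append, List.sum_append,
    List.forall_mem_append, ← hij, Nat.add_left_cancel_iff, and_iff_right hx]

lemma append_mem_wordSet_iff' {x y : List ℕ} (hy : y ∈ wordSet j b) (hij : i + j = N) :
    x ++ y ∈ wordSet N (a + b) ↔ x ∈ wordSet i a := by
  obtain ⟨rfl, rfl, hy⟩ := hy
  simp only [wordSet, Set.mem_ofPred_eq, List.length_append, List.sum_append,
    List.forall_mem_append, ← hij, Nat.add_right_cancel_iff, and_iff_left hy]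

lemma exists_append_of_mem_wordSet {l : List ℕ} (hl : l ∈ wordSet N (a + b)) :
    ∃ i j x y, i + j = N ∧ x ∈ wordSet i a ∧ y ∈ wordSet j b ∧ x ++ y = l := by
  obtain ⟨h_length, h_sum, h_letter⟩ := hl
  refine ⟨_, _, l.take a, l.drop a, ?_, ⟨?_, rfl, fun x hx => h_letter x (List.mem_of_mem_take hx)⟩,
    ⟨?_, rfl, fun x hx => h_letter x (List.mem_of_mem_drop hx)⟩, List.take_append_drop a l⟩
  · rw [List.sum_take_add_sum_drop, h_sum]
  · rw [List.length_take, h_length, Nat.min_eq_left (Nat.le_add_right a b)]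
  · rw [List.length_drop, h_length, Nat.add_sub_cancel_left]

lemma row_mem_gradedPart {x : List ℕ} (hx : x ∈ wordSet i a) (hij : i + j = N) {z : Words}
    (hz : z ∈ gradedPart N (a + b)) : row x z ∈ gradedPart j b := by
  rw [gradedPart, Finsupp.mem_supported'] at hz ⊢
  exact fun l hl => hz _ ((append_mem_wordSet_iff hx hij).not.2 hl)

lemma col_mem_gradedPart {y : List ℕ} (hy : y ∈ wordSet j b) (hij : i + j = N) {z : Words}
    (hz : z ∈ gradedPart N (a + b)) : col y z ∈ gradedPart i a := by
  rw [gradedPart, Finsupp.mem_supported'] at hz ⊢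
  exact fun l hl => hz _ ((append_mem_wordSet_iff' hy hij).not.2 hl)

end

/-- A word is cut into its first `a` and its last `b` letters, for each distribution of the
weight. -/
def appendEquiv (N a b : ℕ) :
    (Σ p : Finset.HasAntidiagonal.antidiagonal N, wordSet p.1.1 a × wordSet p.1.2 b) ≃
      wordSet N (a + b) :=
  .ofBijective
    (fun q => ⟨q.2.1.1 ++ q.2.2.1,
      (append_mem_wordSet_iff q.2.1.2 (Finset.HasAntidiagonal.mem_antidiagonal.1 q.1.2)).2
        q.2.2.2⟩) <| by
    constructor
    · rintro ⟨⟨⟨i, j⟩, _⟩, ⟨x, hx⟩, ⟨y, hy⟩⟩ ⟨⟨⟨i', j'⟩, _⟩, ⟨x', hx'⟩, ⟨y', hy'⟩⟩ h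
      obtain ⟨rfl, rfl⟩ := List.append_inj (congrArg Subtype.val h) (hx.1.trans hx'.1.symm)
      obtain rfl : i = i' := hx.2.1.symm.trans hx'.2.1
      obtain rfl : j = j' := hy.2.1.symm.trans hy'.2.1
      rfl
    · rintro ⟨l, hl⟩
      obtain ⟨i, j, x, y, hij, hx, hy, rfl⟩ := exists_append_of_mem_wordSet hl
      exact ⟨⟨⟨(i, j), Finset.HasAntidiagonal.mem_antidiagonal.2 hij⟩, ⟨x, hx⟩, ⟨y, hy⟩⟩, rfl⟩

/-- The component of weight `N` and depth `a + b` of the tensor product (under concatenation) of the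
part of `A` in depth `a` and the part of `B` in depth `b`. -/
def tensorPart (N a b : ℕ) (A B : Submodule ℚ Words) : Submodule ℚ Words :=
  gradedPart N (a + b) ⊓ ⨅ p ∈ Finset.HasAntidiagonal.antidiagonal N,
    (⨅ x ∈ wordSet p.1 a, B.comap (row x)) ⊓ ⨅ y ∈ wordSet p.2 b, A.comap (col y)

/-- The coefficients in a homogeneous component, arranged as matrices indexed by initial and
final words, with one matrix for each distribution of the weight. -/
def blocks (N a b : ℕ) : gradedPart N (a + b) ≃ₗ[ℚ]
    ((p : Finset.HasAntidiagonal.antidiagonal N) → wordSet p.1.1 a → wordSet p.1.2 b → ℚ) :=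
  gradedPartEquiv N (a + b) ≪≫ₗ LinearEquiv.funCongrLeft ℚ ℚ (appendEquiv N a b) ≪≫ₗ
    LinearEquiv.piCurry ℚ (fun _ _ => ℚ) ≪≫ₗ
      LinearEquiv.piCongrRight fun _ => LinearEquiv.curry ℚ ℚ _ _

section

variable {N a b : ℕ} {A B : Submodule ℚ Words} {z : Words}

lemma mem_tensorPart : z ∈ tensorPart N a b A B ↔ z ∈ gradedPart N (a + b) ∧ ∀ i j, i + j = N →
    (∀ x ∈ wordSet i a, row x z ∈ B) ∧ ∀ y ∈ wordSet j b, col y z ∈ A := by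
  simp only [tensorPart, Submodule.mem_inf, Submodule.mem_iInf, Submodule.mem_comap, Prod.forall,
    Finset.HasAntidiagonal.mem_antidiagonal]

/-- The coefficient vectors of the elements of `A` in a homogeneous component. -/
def coordSub (N r : ℕ) (A : Submodule ℚ Words) : Submodule ℚ (wordSet N r → ℚ) :=
  A.comap ((gradedPart N r).subtype ∘ₗ (gradedPartEquiv N r).symm.toLinearMap)

lemma finrank_coordSub (N r : ℕ) (A : Submodule ℚ Words) :
    Module.finrank ℚ (coordSub N r A) =
      Module.finrank ℚ (A ⊓ gradedPart N r : Submodule ℚ Words) := by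
  rw [coordSub, finrank_comap_of_injective, LinearEquiv.range_comp, Submodule.range_subtype]
  exact Subtype.val_injective.comp (LinearEquiv.injective _)

lemma apply_mem_coordSub_iff {r : ℕ} (hz : z ∈ gradedPart N r) :
    (fun l : wordSet N r => z l) ∈ coordSub N r A ↔ z ∈ A := by
  change ((gradedPartEquiv N r).symm (gradedPartEquiv N r ⟨z, hz⟩) : Words) ∈ A ↔ _
  rw [LinearEquiv.symm_apply_apply]

lemma mem_tensorPart_iff_blocks (z : gradedPart N (a + b)) : (z : Words) ∈ tensorPart N a b A B ↔
    ∀ p, blocks N a b z p ∈ matSub (coordSub p.1.1 a A) (coordSub p.1.2 b B) := by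
  simp only [mem_tensorPart, mem_matSub, z.2, true_and, Subtype.forall, Prod.forall,
    Finset.HasAntidiagonal.mem_antidiagonal]
  refine forall₃_congr fun i j hij => and_congr (forall₂_congr fun x hx => ?_)
    (forall₂_congr fun y hy => ?_)
  · exact (apply_mem_coordSub_iff (row_mem_gradedPart hx hij z.2)).symm
  · exact (apply_mem_coordSub_iff (col_mem_gradedPart hy hij z.2)).symm

variable (N a b A B) in
/-- A tensor product of subspaces as a family of spaces of matrices. -/
def tensorPartEquiv : tensorPart N a b A B ≃ₗ[ℚ]
    ((p : Finset.HasAntidiagonal.antidiagonal N) →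
      matSub (coordSub p.1.1 a A) (coordSub p.1.2 b B)) where
  toFun z p := ⟨blocks N a b ⟨z.1, (mem_tensorPart.1 z.2).1⟩ p,
    (mem_tensorPart_iff_blocks ⟨z.1, (mem_tensorPart.1 z.2).1⟩).1 z.2 p⟩
  map_add' _ _ := rfl
  map_smul' _ _ := rfl
  invFun f := ⟨(blocks N a b).symm fun p => f p, (mem_tensorPart_iff_blocks _).2 fun p => by
    rw [LinearEquiv.apply_symm_apply]
    exact (f p).2⟩
  left_inv z := Subtype.ext congr((
    $((blocks N a b).symm_apply_apply ⟨z.1, (mem_tensorPart.1 z.2).1⟩) : Words))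
  right_inv f := funext fun p => Subtype.ext <| congrFun ((blocks N a b).apply_symm_apply _) p

lemma finrank_tensorPart (N a b : ℕ) (A B : Submodule ℚ Words) :
    Module.finrank ℚ (tensorPart N a b A B) =
      ∑ p ∈ Finset.HasAntidiagonal.antidiagonal N,
        Module.finrank ℚ (A ⊓ gradedPart p.1 a : Submodule ℚ Words) *
          Module.finrank ℚ (B ⊓ gradedPart p.2 b : Submodule ℚ Words) := by
  simp only [(tensorPartEquiv N a b A B).finrank_eq, Module.finrank_pi_fintype, finrank_matSub,
    finrank_coordSub]
  exact Finset.sum_coe_sort _ fun p : ℕ × ℕ =>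
    Module.finrank ℚ (A ⊓ gradedPart p.1 a : Submodule ℚ Words) *
      Module.finrank ℚ (B ⊓ gradedPart p.2 b : Submodule ℚ Words)

end

/-! ### Polynomials of words and the three-term relation -/

/-- The polynomial `∑ z(m₁ ⋯ m_r) x₁^(m₁-1) ⋯ x_r^(m_r-1)` of an element `z` of the free algebra; it
is only meant for elements of depth `r`. -/
def toPoly (r : ℕ) : Words →ₗ[ℚ] MvPolynomial (Fin r) ℚ :=
  Finsupp.linearCombination ℚ fun l : List ℕ => monomial (expo fun i : Fin r => l.getD i 0) 1

lemma toPoly_single (r : ℕ) (l : List ℕ) :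
    toPoly r (Finsupp.single l 1) = monomial (expo fun i : Fin r => l.getD i 0) 1 := by
  simp [toPoly]

lemma toPoly_single_ofFn {r : ℕ} (m : Fin r → ℕ) :
    toPoly r (Finsupp.single (List.ofFn m) 1) = monomial (expo m) 1 := by
  simp [toPoly_single]

lemma toPoly_prepend (r a : ℕ) (w : Words) :
    toPoly (r + 1) (prepend a w) = X 0 ^ (a - 1) * rename Fin.succ (toPoly r w) := by
  have h : toPoly (r + 1) ∘ₗ prepend a =
      LinearMap.mulLeft ℚ (X 0 ^ (a - 1)) ∘ₗ (rename Fin.succ).toLinearMap ∘ₗ toPoly r :=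
    words_ext fun l => by simp [toPoly_single, monomial_expo_succ]
  exact congr($h w)

lemma toPoly_prepend₂ {N : ℕ} {P : MvPolynomial (Fin 2) ℚ} (hP : P ∈ V N 2) (r : ℕ) (w : Words) :
    toPoly (r + 2) (prepend₂ P w) =
      rename ![0, 1] P * rename Fin.succ (rename Fin.succ (toPoly r w)) := by
  refine V_two_eqOn (f := toPoly (r + 2) ∘ₗ LinearMap.applyₗ w ∘ₗ prepend₂)
    (g := LinearMap.mulRight ℚ (rename Fin.succ (rename Fin.succ (toPoly r w))) ∘ₗ
      (rename ![0, 1]).toLinearMap) (fun i j hi hj _ => ?_) hP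
  simp [prepend₂_X_pow, hi, hj, toPoly_prepend, mul_assoc]

lemma exists_ofFn_of_mem_wordSet {N r : ℕ} {l : List ℕ} (hl : l ∈ wordSet N r) :
    ∃ m : Idx N r, List.ofFn m.1 = l :=
  ⟨(idxEquivWordSet N r).symm ⟨l, hl⟩,
    congrArg Subtype.val ((idxEquivWordSet N r).apply_symm_apply ⟨l, hl⟩)⟩

lemma toPoly_single_pair (a b : ℕ) :
    toPoly 2 (Finsupp.single [a, b] 1) = X 0 ^ (a - 1) * X 1 ^ (b - 1) := by
  rw [← prepend_single, ← prepend_single, toPoly_prepend, toPoly_prepend, toPoly_single]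
  simp [Subsingleton.elim (expo _) (0 : Fin 0 →₀ ℕ)]

section

variable {N r : ℕ}

lemma coeff_toPoly {z : Words} (hz : z ∈ gradedPart N r) {n : Fin r → ℕ}
    (hn : ∀ i, IsLetter (n i)) : coeff (expo n) (toPoly r z) = z (List.ofFn n) := by
  refine gradedPart_eqOn (f := lcoeff ℚ (expo n) ∘ₗ toPoly r)
    (g := Finsupp.lapply (List.ofFn n)) (fun l hl => ?_) hz
  obtain ⟨m, rfl⟩ := exists_ofFn_of_mem_wordSet hl
  simp only [LinearMap.comp_apply, toPoly_single_ofFn, lcoeff_apply, coeff_monomial,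
    Finsupp.lapply_apply, Finsupp.single_apply, List.ofFn_inj,
    expo_inj (mem_oddIndices.1 m.2).2 hn]

lemma coeffVec_toPoly (z : gradedPart N r) :
    coeffVec N r (toPoly r z) = (toWords N r).symm z :=
  funext fun n => coeff_toPoly z.2 (mem_oddIndices.1 n.2).2

lemma toPoly_comp_subtype_injective (N r : ℕ) :
    Function.Injective (toPoly r ∘ₗ (gradedPart N r).subtype) := fun z w h =>
  (toWords N r).symm.injective <| by
    rw [← coeffVec_toPoly, ← coeffVec_toPoly]
    exact congrArg (coeffVec N r) h

lemma range_toPoly_comp_subtype (N r : ℕ) :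
    LinearMap.range (toPoly r ∘ₗ (gradedPart N r).subtype) = V N r := by
  rw [LinearMap.range_comp, Submodule.range_subtype, gradedPart,
    Finsupp.supported_eq_span_single, Submodule.map_span, V]
  congr 1
  ext P
  constructor
  · rintro ⟨_, ⟨l, hl, rfl⟩, rfl⟩
    obtain ⟨m, rfl⟩ := exists_ofFn_of_mem_wordSet hl
    exact ⟨m, (toPoly_single_ofFn m.1).symm⟩
  · rintro ⟨m, rfl⟩
    exact ⟨_, ⟨_, ofFn_mem_wordSet.2 m.2, rfl⟩, toPoly_single_ofFn m.1⟩

end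

/-- The difference of the two sides of the three-term relation that defines `W`. -/
def threeTermDefect (r : ℕ) (hr : 2 ≤ r) : MvPolynomial (Fin r) ℚ →ₗ[ℚ] MvPolynomial (Fin r) ℚ :=
  LinearMap.id - ((substA r hr).toLinearMap - (substB r hr).toLinearMap)

lemma W_eq_inf_ker (N r : ℕ) (hr : 2 ≤ r) :
    W N r hr = V N r ⊓ LinearMap.ker (threeTermDefect r hr) := by
  rw [W, LinearMap.eqLocus_eq_ker_sub, threeTermDefect]

/-- The elements of the free algebra whose polynomial satisfies the three-term relation. -/
def periodWords (r : ℕ) (hr : 2 ≤ r) : Submodule ℚ Words :=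
  LinearMap.ker (threeTermDefect r hr ∘ₗ toPoly r)

section

variable {N r : ℕ} {hr : 2 ≤ r}

lemma W_eq_map (N r : ℕ) (hr : 2 ≤ r) : W N r hr =
    ((periodWords r hr).comap (gradedPart N r).subtype).map
      (toPoly r ∘ₗ (gradedPart N r).subtype) := by
  rw [periodWords, LinearMap.ker_comp, ← Submodule.comap_comp, Submodule.map_comap_eq,
    range_toPoly_comp_subtype, W_eq_inf_ker]

lemma finrank_W_eq (N r : ℕ) (hr : 2 ≤ r) : Module.finrank ℚ (W N r hr) =
    Module.finrank ℚ (periodWords r hr ⊓ gradedPart N r : Submodule ℚ Words) := by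
  rw [W_eq_map,
    ← (Submodule.equivMapOfInjective _ (toPoly_comp_subtype_injective N r) _).finrank_eq,
    finrank_comap_of_injective Subtype.val_injective, Submodule.range_subtype]

lemma toPoly_mem_W {z : Words} (hz : z ∈ periodWords r hr ⊓ gradedPart N r) :
    toPoly r z ∈ W N r hr :=
  W_eq_map N r hr ▸ ⟨⟨z, hz.2⟩, hz.1, rfl⟩

lemma exists_toPoly_eq {P : MvPolynomial (Fin r) ℚ} (hP : P ∈ W N r hr) :
    ∃ z ∈ periodWords r hr ⊓ gradedPart N r, toPoly r z = P := by
  rw [W_eq_map] at hP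
  obtain ⟨z, hz, rfl⟩ := hP
  exact ⟨z, ⟨hz, z.2⟩, rfl⟩

end

section

variable {k : ℕ} (P : MvPolynomial (Fin 2) ℚ) (Q : MvPolynomial (Fin k) ℚ)

lemma substA_rename_mul_rename :
    substA (k + 2) (by omega) (rename ![0, 1] P * rename Fin.succ (rename Fin.succ Q)) =
      rename ![0, 1] (substA 2 le_rfl P) * rename Fin.succ (rename Fin.succ Q) := by
  have h_left : (substA (k + 2) (by omega)).comp (rename ![0, 1]) =
      (rename (![0, 1] : Fin 2 → Fin (k + 2))).comp (substA 2 le_rfl) := by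
    ext1 i
    fin_cases i <;> simp [substA]
  have h_right : (substA (k + 2) (by omega)).comp ((rename Fin.succ).comp (rename Fin.succ)) =
      (rename (Fin.succ : Fin (k + 1) → Fin (k + 2))).comp (rename Fin.succ) := by
    ext1 i
    simp [substA]
  rw [map_mul]
  exact congr($h_left P * $h_right Q)

lemma substB_rename_mul_rename :
    substB (k + 2) (by omega) (rename ![0, 1] P * rename Fin.succ (rename Fin.succ Q)) =
      rename ![0, 1] (substB 2 le_rfl P) * rename Fin.succ (rename Fin.succ Q) := by
  have h_left : (substB (k + 2) (by omega)).comp (rename ![0, 1]) =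
      (rename (![0, 1] : Fin 2 → Fin (k + 2))).comp (substB 2 le_rfl) := by
    ext1 i
    fin_cases i <;> simp [substB]
  have h_right : (substB (k + 2) (by omega)).comp ((rename Fin.succ).comp (rename Fin.succ)) =
      (rename (Fin.succ : Fin (k + 1) → Fin (k + 2))).comp (rename Fin.succ) := by
    ext1 i
    simp [substB]
  rw [map_mul]
  exact congr($h_left P * $h_right Q)

lemma threeTermDefect_rename_mul_rename :
    threeTermDefect (k + 2) (by omega) (rename ![0, 1] P * rename Fin.succ (rename Fin.succ Q)) =
      rename ![0, 1] (threeTermDefect 2 le_rfl P) * rename Fin.succ (rename Fin.succ Q) := by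
  simp only [threeTermDefect, LinearMap.sub_apply, LinearMap.id_apply,
    AlgHom.toLinearMap_apply, substA_rename_mul_rename, substB_rename_mul_rename, map_sub, sub_mul]

end

/-! ### Period polynomials in the first two letters -/

/-- Right multiplication by a word in the free algebra. -/
def appendWord (y : List ℕ) : Words →ₗ[ℚ] Words := Finsupp.lmapDomain ℚ ℚ (· ++ y)

lemma appendWord_single (y l : List ℕ) (c : ℚ) :
    appendWord y (Finsupp.single l c) = Finsupp.single (l ++ y) c :=
  Finsupp.mapDomain_single

lemma appendWord_col_apply (y : List ℕ) (z : Words) (l : List ℕ) :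
    appendWord y (col y z) l = if y <:+ l then z l else 0 := by
  split_ifs with h
  · obtain ⟨x, rfl⟩ := h
    exact Finsupp.mapDomain_apply (List.append_left_injective y) _ x
  · exact Finsupp.mapDomain_of_notMem_range _ _ fun ⟨x, hx⟩ => h ⟨x, hx⟩

section

variable {N a b : ℕ}

lemma eq_sum_appendWord_col {z : Words} (hz : z ∈ gradedPart N (a + b)) :
    z = ∑ y ∈ z.support.image (List.drop a), appendWord y (col y z) := by
  ext l
  rw [Finsupp.finsetSum_apply]
  simp only [appendWord_col_apply]
  by_cases hl : z l = 0
  · simp only [hl, ite_self, Finset.sum_const_zero]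
  have h_length (l : List ℕ) (hl : l ∈ z.support) : l.length = a + b := (hz hl).1
  have hl_mem := Finsupp.mem_support_iff.2 hl
  rw [Finset.sum_eq_single (l.drop a), if_pos (List.drop_suffix a l)]
  · intro y hy h_ne
    obtain ⟨l', hl', rfl⟩ := Finset.mem_image.1 hy
    rw [if_neg]
    rw [List.suffix_iff_eq_drop, List.length_drop, h_length l hl_mem, h_length l' hl',
      Nat.add_sub_cancel_left, Nat.add_sub_cancel]
    exact h_ne
  · exact fun h => absurd (Finset.mem_image_of_mem _ hl_mem) h

lemma tensorPart_top_le {A S : Submodule ℚ Words}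
    (h : ∀ i j, i + j = N → ∀ u ∈ A ⊓ gradedPart i a, ∀ y ∈ wordSet j b, appendWord y u ∈ S) :
    tensorPart N a b A ⊤ ≤ S := by
  intro z hz
  obtain ⟨hz_mem, hz⟩ := mem_tensorPart.1 hz
  rw [eq_sum_appendWord_col hz_mem]
  refine S.sum_mem fun _ h_drop => ?_
  obtain ⟨l, hl, rfl⟩ := Finset.mem_image.1 h_drop
  obtain ⟨i, j, x, y, hij, hx, hy, rfl⟩ := exists_append_of_mem_wordSet (hz_mem hl)
  rw [← hx.1, List.drop_left]
  exact h i j hij _ ⟨(hz i j hij).2 y hy, col_mem_gradedPart hy hij hz_mem⟩ y hy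

end

lemma appendWord_eq_prepend₂ {N : ℕ} {u : Words} (hu : u ∈ gradedPart N 2) (y : List ℕ) :
    appendWord y u = prepend₂ (toPoly 2 u) (Finsupp.single y 1) := by
  refine gradedPart_eqOn (f := appendWord y)
    (g := LinearMap.applyₗ (Finsupp.single y 1) ∘ₗ prepend₂ ∘ₗ toPoly 2) (fun l hl => ?_) hu
  obtain ⟨a, b, rfl⟩ := List.length_eq_two.1 hl.1
  have ha : IsLetter a := hl.2.2 a (by simp)
  have hb : IsLetter b := hl.2.2 b (by simp)
  have ha_pos : a - 1 + 1 = a := Nat.sub_add_cancel (by have := ha.1; omega)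
  have hb_pos : b - 1 + 1 = b := Nat.sub_add_cancel (by have := hb.1; omega)
  simp [appendWord_single, toPoly_single_pair, prepend₂_X_pow, ha_pos, hb_pos, ha, hb]

lemma tensorPart_periodWords_le {N k : ℕ} {S : Submodule ℚ Words}
    (h : ∀ i, ∀ P ∈ W i 2 le_rfl, ∀ w, prepend₂ P w ∈ S) :
    tensorPart N 2 k (periodWords 2 le_rfl) ⊤ ≤ S :=
  tensorPart_top_le fun i _ _ u hu y _ => by
    rw [appendWord_eq_prepend₂ hu.2]
    exact h i _ (toPoly_mem_W hu) _

lemma prepend₂_mem_periodWords {N : ℕ} {P : MvPolynomial (Fin 2) ℚ} (hP : P ∈ W N 2 le_rfl)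
    (k : ℕ) (w : Words) : prepend₂ P w ∈ periodWords (k + 2) (by omega) := by
  rw [W_eq_inf_ker] at hP
  rw [periodWords, LinearMap.mem_ker, LinearMap.comp_apply, toPoly_prepend₂ hP.1,
    threeTermDefect_rename_mul_rename, LinearMap.mem_ker.1 hP.2, map_zero, zero_mul]

lemma col_single_append {x y y' : List ℕ} (h : y.length = y'.length) :
    col y' (Finsupp.single (x ++ y) 1) = if y = y' then Finsupp.single x 1 else 0 := by
  ext l
  have h_iff : x ++ y = l ++ y' ↔ x = l ∧ y = y' :=
    ⟨fun h_eq => List.append_inj' h_eq h, fun ⟨hx, hy⟩ => by rw [hx, hy]⟩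
  rw [col_apply, Finsupp.single_apply]
  simp only [h_iff]
  split_ifs <;> simp_all

lemma coeff_threeTermDefect_toPoly {N k j : ℕ} {z : Words} (hz : z ∈ gradedPart N (2 + k))
    (n : Idx j k) (a b : ℕ) :
    coeff (expo (Fin.cons (a + 1) (Fin.cons (b + 1) n.1)))
        (threeTermDefect (k + 2) (by omega) (toPoly (k + 2) z)) =
      coeff (Finsupp.equivFunOnFinite.symm ![a, b])
        (threeTermDefect 2 le_rfl (toPoly 2 (col (List.ofFn n.1) z))) := by
  refine gradedPart_eqOn (f := lcoeff ℚ _ ∘ₗ threeTermDefect (k + 2) (by omega) ∘ₗ toPoly (k + 2))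
    (g := lcoeff ℚ _ ∘ₗ threeTermDefect 2 le_rfl ∘ₗ toPoly 2 ∘ₗ col (List.ofFn n.1))
    (fun l hl => ?_) hz
  obtain ⟨i, j', x, y, _, hx, hy, rfl⟩ := exists_append_of_mem_wordSet hl
  have hx_mem := single_mem_gradedPart hx 1
  have hV : toPoly 2 (Finsupp.single x 1) ∈ V i 2 :=
    range_toPoly_comp_subtype i 2 ▸ ⟨⟨_, hx_mem⟩, rfl⟩
  simp only [LinearMap.comp_apply, lcoeff_apply]
  rw [col_single_append (by rw [hy.1, List.length_ofFn]), ← appendWord_single,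
    appendWord_eq_prepend₂ hx_mem, toPoly_prepend₂ hV, threeTermDefect_rename_mul_rename,
    coeff_rename_mul_rename]
  simp only [Fin.cons_succ, coeff_toPoly (single_mem_gradedPart hy 1) (mem_oddIndices.1 n.2).2]
  split_ifs with h <;> simp [h]

lemma tensorPart_periodWords (N k : ℕ) : tensorPart N 2 k (periodWords 2 le_rfl) ⊤ =
    periodWords (k + 2) (by omega) ⊓ gradedPart N (k + 2) := by
  have h_comm : gradedPart N (k + 2) = gradedPart N (2 + k) := by rw [Nat.add_comm]
  rw [h_comm]
  refine le_antisymm (le_inf ?_ inf_le_left) fun z hz => ?_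
  · exact tensorPart_periodWords_le fun _ _ hP w => prepend₂_mem_periodWords hP k w
  · refine mem_tensorPart.2 ⟨hz.2, fun i j _ => ⟨fun _ _ => Submodule.mem_top, fun y hy => ?_⟩⟩
    obtain ⟨n, rfl⟩ := exists_ofFn_of_mem_wordSet hy
    ext e
    have h := coeff_threeTermDefect_toPoly hz.2 n (e 0) (e 1)
    have h_eq : Finsupp.equivFunOnFinite.symm ![e 0, e 1] = e := by
      ext i
      fin_cases i <;> rfl
    have h_zero : threeTermDefect (k + 2) (by omega) (toPoly (k + 2) z) = 0 := hz.1
    rwa [h_zero, h_eq, coeff_zero, eq_comm] at h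

/-! ### The kernel of the total action -/

lemma tailMap_tailMap_prepend₂ {N : ℕ} {P : MvPolynomial (Fin 2) ℚ} (hP : P ∈ V N 2)
    (f : Words →ₗ[ℚ] Words) (w : Words) :
    tailMap (tailMap f) (prepend₂ P w) = prepend₂ P (f w) := by
  simp only [prepend₂_eq_pairLift hP, map_pairLift, tailMap_prepend]

section

variable {N k : ℕ} {S : Submodule ℚ Words} {z : Words}

lemma periodWords_inf_gradedPart_le (h : ∀ i, ∀ P ∈ W i 2 le_rfl, ∀ w, prepend₂ P w ∈ S) :
    periodWords (k + 2) (by omega) ⊓ gradedPart N (k + 2) ≤ S :=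
  tensorPart_periodWords N k ▸ tensorPart_periodWords_le h

lemma act_add_tailMap_act (hz : z ∈ periodWords (k + 2) (by omega) ⊓ gradedPart N (k + 2)) :
    act z + tailMap act z = z :=
  periodWords_inf_gradedPart_le (S := LinearMap.eqLocus (act + tailMap act) LinearMap.id)
    (fun _ _ hP w => act_add_tailMap_act_prepend₂ hP w) hz

lemma act_tailMap_act (hz : z ∈ periodWords (k + 2) (by omega) ⊓ gradedPart N (k + 2)) :
    act (tailMap act z) = 0 :=
  periodWords_inf_gradedPart_le (S := LinearMap.ker (act ∘ₗ tailMap act))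
    (fun _ _ hP w => act_tailMap_act_prepend₂ hP w) hz

lemma tailMap_tailMap_mem_periodWords {f : Words →ₗ[ℚ] Words} (hf : IsGraded f)
    (hz : z ∈ periodWords (k + 2) (by omega) ⊓ gradedPart N (k + 2)) :
    tailMap (tailMap f) z ∈ periodWords (k + 2) (by omega) ⊓ gradedPart N (k + 2) := by
  refine Submodule.mem_inf.2 ⟨?_, isGraded_tailMap (isGraded_tailMap hf) _ _ _ hz.2⟩
  refine Submodule.mem_comap.1 (periodWords_inf_gradedPart_le (fun i P hP w => ?_) hz)
  rw [Submodule.mem_comap, tailMap_tailMap_prepend₂ (mem_W.1 hP).1]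
  exact prepend₂_mem_periodWords hP k _

lemma tailMap_act_tailMap_tailMap_fullAct (hz : z ∈ gradedPart N (k + 2)) :
    tailMap act (tailMap (tailMap fullAct) z) = tailMap fullAct z :=
  tailMap_iterate_act_comp_fullAct (k := 1) (by omega) hz

lemma periodWords_le_ker_fullAct :
    periodWords (k + 2) (by omega) ⊓ gradedPart N (k + 2) ≤ LinearMap.ker fullAct := fun z hz => by
  rw [LinearMap.mem_ker, fullAct_eq_act_tailMap hz.2, ← tailMap_act_tailMap_tailMap_fullAct hz.2,
    act_tailMap_act (tailMap_tailMap_mem_periodWords isGraded_fullAct hz)]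

end

lemma row_cons (a : ℕ) (x : List ℕ) (z : Words) : row (a :: x) z = row x (row [a] z) :=
  Finsupp.ext fun _ => rfl

lemma row_singleton_prepend (a b : ℕ) (w : Words) :
    row [a] (prepend b w) = if b = a then w else 0 := by
  have h : row [a] ∘ₗ prepend b = if b = a then LinearMap.id else 0 := words_ext fun l => by
    ext l'
    rw [LinearMap.comp_apply, prepend_single, row_apply, Finsupp.single_apply]
    split_ifs <;> simp_all
  rw [← LinearMap.comp_apply, h]
  split_ifs <;> rfl

lemma row_singleton_tailMap (f : Words →ₗ[ℚ] Words) (a : ℕ) (z : Words) :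
    row [a] (tailMap f z) = f (row [a] z) := by
  have h : row [a] ∘ₗ tailMap f = f ∘ₗ row [a] := words_ext fun l => by
    cases l with
    | nil =>
      have h_row : row [a] (Finsupp.single [] 1) = 0 := by
        ext l
        simp [row_apply]
      simp [tailMap, h_row]
    | cons b l =>
      rw [LinearMap.comp_apply, LinearMap.comp_apply, ← prepend_single, tailMap_prepend,
        row_singleton_prepend, row_singleton_prepend]
      split_ifs
      · rfl
      · rw [map_zero]
  exact congr($h z)

lemma tailMap_eq_zero {N k : ℕ} {f : Words →ₗ[ℚ] Words} (hf : IsGraded f) {z : Words}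
    {A : Submodule ℚ Words} (hz : z ∈ tensorPart N 1 k A (LinearMap.ker f)) :
    tailMap f z = 0 := by
  obtain ⟨hz_mem, hz⟩ := mem_tensorPart.1 hz
  have h_supp := (Finsupp.mem_supported' _ _).1 (isGraded_tailMap hf _ _ _ hz_mem)
  ext l
  by_cases hl : l ∈ wordSet N (1 + k)
  · obtain ⟨i, j, x, y, hij, hx, -, rfl⟩ := exists_append_of_mem_wordSet hl
    obtain ⟨a, rfl⟩ := List.length_eq_one_iff.1 hx.1
    have h_row := (hz i j hij).1 _ hx
    rw [LinearMap.mem_ker, ← row_singleton_tailMap] at h_row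
    exact congr($h_row y)
  · exact h_supp l hl

/-! ### Tasaka's map -/

lemma mem_rightKer_transpose {ι : Type} [Fintype ι] {A : Matrix ι ι ℚ} {u : ι → ℚ} :
    u ∈ rightKer A.transpose ↔ Matrix.vecMul u A = 0 := by
  rw [rightKer, LinearMap.mem_ker, Matrix.mulVecLin_apply, Matrix.mulVec_transpose]

lemma finrank_rightKer_transpose {ι : Type} [Fintype ι] (A : Matrix ι ι ℚ) :
    Module.finrank ℚ (rightKer A.transpose) = Module.finrank ℚ (rightKer A) := by
  have h := A.mulVecLin.finrank_range_add_finrank_ker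
  have h_transpose := A.transpose.mulVecLin.finrank_range_add_finrank_ker
  have h_rank := A.rank_transpose
  rw [Matrix.rank, Matrix.rank] at h_rank
  rw [rightKer, rightKer]
  omega

section

variable {N r : ℕ} {hr : 2 ≤ r} {z : Words}

lemma toWords_tasakaMap (hz : z ∈ periodWords r hr ⊓ gradedPart N r) :
    (toWords N r (tasakaMap N r hr ⟨toPoly r z, toPoly_mem_W hz⟩) : Words) = act z - z := by
  have h_coeff : coeffVec N r (toPoly r z) = (toWords N r).symm ⟨z, hz.2⟩ :=
    coeffVec_toPoly ⟨z, hz.2⟩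
  change (toWords N r (Matrix.vecMul (coeffVec N r (toPoly r z)) (E N r - 1)) : Words) = _
  rw [Matrix.vecMul_sub, Matrix.vecMul_one, map_sub, Submodule.coe_sub, toWords_vecMul_E, h_coeff,
    LinearEquiv.apply_symm_apply]

lemma tasakaMap_toPoly_eq_zero_iff (hz : z ∈ periodWords r hr ⊓ gradedPart N r) :
    tasakaMap N r hr ⟨toPoly r z, toPoly_mem_W hz⟩ = 0 ↔ act z = z := by
  rw [← (toWords N r).map_eq_zero_iff, ← Submodule.coe_eq_zero, toWords_tasakaMap hz, sub_eq_zero]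

lemma tasakaMap_injective_iff : Function.Injective (tasakaMap N r hr) ↔
    ∀ z ∈ periodWords r hr ⊓ gradedPart N r, act z = z → z = 0 := by
  rw [injective_iff_map_eq_zero]
  refine ⟨fun h z hz hact => ?_, fun h P hP => ?_⟩
  · have h_poly : toPoly r z = 0 :=
      congrArg Subtype.val (h _ ((tasakaMap_toPoly_eq_zero_iff hz).2 hact))
    have h_zero : (⟨z, hz.2⟩ : gradedPart N r) = 0 :=
      (map_eq_zero_iff _ (toPoly_comp_subtype_injective N r)).1 h_poly
    exact congrArg Subtype.val h_zero
  · obtain ⟨P, hP_mem⟩ := P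
    obtain ⟨z, hz, rfl⟩ := exists_toPoly_eq hP_mem
    rw [Submodule.mk_eq_zero, h z hz ((tasakaMap_toPoly_eq_zero_iff hz).1 hP), map_zero]

end

lemma tailMap_act_eq_self {N : ℕ} {z : Words} (hz : z ∈ gradedPart N 2) : tailMap act z = z := by
  refine gradedPart_eqOn (f := tailMap act) (g := LinearMap.id) (fun l hl => ?_) hz
  obtain ⟨a, b, rfl⟩ := List.length_eq_two.1 hl.1
  rw [← prepend_single, tailMap_prepend, act_single_cons, derWord, add_zero, LinearMap.id_apply]

lemma tasakaMap_two_injective (N : ℕ) : Function.Injective (tasakaMap N 2 le_rfl) :=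
  tasakaMap_injective_iff.2 fun z hz hact => by
    have h := act_add_tailMap_act (k := 0) hz
    rwa [hact, tailMap_act_eq_self hz.2, add_eq_left] at h

lemma range_tasakaMap_le (N k : ℕ) : LinearMap.range (tasakaMap N (k + 2) (by omega)) ≤
    rightKer (E N (k + 2)).transpose := by
  rintro _ ⟨⟨P, hP⟩, rfl⟩
  obtain ⟨z, hz, rfl⟩ := exists_toPoly_eq hP
  rw [mem_rightKer_transpose, ← (toWords N (k + 2)).map_eq_zero_iff, ← Submodule.coe_eq_zero,
    toWords_vecMul_E, toWords_tasakaMap hz, ← neg_sub,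
    ← eq_sub_iff_add_eq'.2 (act_add_tailMap_act hz), map_neg, act_tailMap_act hz, neg_zero]

/-! ### Dimensions -/

instance (N r : ℕ) : FiniteDimensional ℚ (gradedPart N r) :=
  Module.Finite.equiv (toWords N r)

lemma finrank_top_inf_gradedPart (N r : ℕ) :
    Module.finrank ℚ (⊤ ⊓ gradedPart N r : Submodule ℚ Words) = (oddIndices N r).card := by
  rw [top_inf_eq, ← (toWords N r).finrank_eq, Module.finrank_fintype_fun_eq_card, Fintype.card_coe]

lemma finrank_periodWords_two (N : ℕ) :
    Module.finrank ℚ (periodWords 2 le_rfl ⊓ gradedPart N 2 : Submodule ℚ Words) = cuspDim N := by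
  rw [← finrank_W_eq, finrank_W_two]

lemma finrank_W (N k : ℕ) : Module.finrank ℚ (W N (k + 2) (by omega)) =
    ∑ p ∈ Finset.HasAntidiagonal.antidiagonal N, cuspDim p.1 * (oddIndices p.2 k).card := by
  rw [finrank_W_eq, ← tensorPart_periodWords, finrank_tensorPart]
  simp only [finrank_periodWords_two, finrank_top_inf_gradedPart]

/-- The dimension of the kernel of the total action in weight `N` and depth `r`. -/
def kerDim (N r : ℕ) : ℕ :=
  Module.finrank ℚ (LinearMap.ker fullAct ⊓ gradedPart N r : Submodule ℚ Words)

lemma kerDim_eq_zero {N r : ℕ} (h : ∀ l ∈ wordSet N r,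
    fullAct (Finsupp.single l 1) = Finsupp.single l 1) : kerDim N r = 0 := by
  rw [kerDim, Submodule.finrank_eq_zero, eq_bot_iff]
  rintro z ⟨hz_ker, hz⟩
  rw [Submodule.mem_bot, ← LinearMap.mem_ker.1 hz_ker]
  exact (gradedPart_eqOn (f := fullAct) (g := LinearMap.id) h hz).symm

lemma kerDim_zero (N : ℕ) : kerDim N 0 = 0 :=
  kerDim_eq_zero fun l hl => by rw [List.length_eq_zero_iff.1 hl.1, fullAct_nil]

lemma kerDim_one (N : ℕ) : kerDim N 1 = 0 :=
  kerDim_eq_zero fun _ hl => tailMap_iterate_fullAct_single (k := 0) hl.1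

lemma finrank_rightKer_C (N k : ℕ) :
    Module.finrank ℚ (rightKer (C N (k + 2))) = kerDim N (k + 2) := by
  have h_comap : rightKer (C N (k + 2)).transpose =
      (LinearMap.ker fullAct).comap ((gradedPart N (k + 2)).subtype ∘ₗ (toWords N (k + 2))) := by
    ext u
    rw [mem_rightKer_transpose, Submodule.mem_comap, LinearMap.mem_ker, LinearMap.comp_apply,
      LinearEquiv.coe_coe, Submodule.subtype_apply, ← toWords_vecMul_C (by omega),
      Submodule.coe_eq_zero, LinearEquiv.map_eq_zero_iff]
  rw [← finrank_rightKer_transpose, h_comap, finrank_comap_of_injective, LinearEquiv.range_comp,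
    Submodule.range_subtype, kerDim]
  exact Subtype.val_injective.comp (LinearEquiv.injective _)

section

variable {N k : ℕ}

lemma tensorPart_one_le_ker_fullAct :
    tensorPart N 1 (k + 1) ⊤ (LinearMap.ker fullAct) ≤
      LinearMap.ker fullAct ⊓ gradedPart N (k + 2) := fun z hz => by
  have hz_mem := (mem_tensorPart.1 hz).1
  rw [Nat.add_comm] at hz_mem
  refine Submodule.mem_inf.2 ⟨?_, hz_mem⟩
  rw [LinearMap.mem_ker, fullAct_eq_act_tailMap hz_mem, tailMap_eq_zero isGraded_fullAct hz,
    map_zero]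

lemma tensorPart_two_le_ker_fullAct :
    tensorPart N 2 k (periodWords 2 le_rfl) ⊤ ≤ LinearMap.ker fullAct ⊓ gradedPart N (k + 2) := by
  rw [tensorPart_periodWords]
  exact le_inf periodWords_le_ker_fullAct inf_le_right

/-- For `v` in the intersection, the image of `v` under the total action on all but the first two
letters satisfies the hypothesis of the injectivity of Tasaka's map, hence vanishes. -/
lemma tensorPart_one_inf_tensorPart_two_le
    (hinj : Function.Injective (tasakaMap N (k + 2) (by omega))) :
    tensorPart N 1 (k + 1) ⊤ (LinearMap.ker fullAct) ⊓ tensorPart N 2 k (periodWords 2 le_rfl) ⊤ ≤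
      tensorPart N 2 k (periodWords 2 le_rfl) (LinearMap.ker fullAct) := by
  rintro v ⟨hv_one, hv_two⟩
  have hv := tensorPart_periodWords N k ▸ hv_two
  have hw := tailMap_tailMap_mem_periodWords isGraded_fullAct hv
  have h_act := act_add_tailMap_act hw
  rw [tailMap_act_tailMap_tailMap_fullAct hv.2, tailMap_eq_zero isGraded_fullAct hv_one,
    add_zero] at h_act
  have hw_zero := tasakaMap_injective_iff.1 hinj _ hw h_act
  obtain ⟨hv_mem, hv_two⟩ := mem_tensorPart.1 hv_two
  refine mem_tensorPart.2 ⟨hv_mem, fun i j hij => ⟨fun x hx => ?_, (hv_two i j hij).2⟩⟩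
  obtain ⟨a, b, rfl⟩ := List.length_eq_two.1 hx.1
  rw [LinearMap.mem_ker, row_cons, ← row_singleton_tailMap, ← row_singleton_tailMap, hw_zero,
    map_zero, map_zero]

lemma kerDim_add_le (hinj : Function.Injective (tasakaMap N (k + 2) (by omega))) :
    (∑ p ∈ Finset.HasAntidiagonal.antidiagonal N, (oddIndices p.1 1).card * kerDim p.2 (k + 1)) +
      ∑ p ∈ Finset.HasAntidiagonal.antidiagonal N, cuspDim p.1 * (oddIndices p.2 k).card ≤
    kerDim N (k + 2) +
      ∑ p ∈ Finset.HasAntidiagonal.antidiagonal N, cuspDim p.1 * kerDim p.2 k := by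
  have h_one := finrank_tensorPart N 1 (k + 1) ⊤ (LinearMap.ker fullAct)
  have h_two := finrank_tensorPart N 2 k (periodWords 2 le_rfl) ⊤
  have h_inf := finrank_tensorPart N 2 k (periodWords 2 le_rfl) (LinearMap.ker fullAct)
  simp only [finrank_periodWords_two, finrank_top_inf_gradedPart] at h_one h_two h_inf
  simp only [kerDim]
  rw [← h_one, ← h_two, ← h_inf]
  have (A B : Submodule ℚ Words) (a b : ℕ) : FiniteDimensional ℚ (tensorPart N a b A B) :=
    Submodule.finiteDimensional_of_le inf_le_left
  have : FiniteDimensional ℚ (LinearMap.ker fullAct ⊓ gradedPart N (k + 2) : Submodule ℚ Words) :=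
    Submodule.finiteDimensional_of_le inf_le_right
  rw [← Submodule.finrank_sup_add_finrank_inf_eq]
  exact add_le_add
    (Submodule.finrank_mono (sup_le tensorPart_one_le_ker_fullAct tensorPart_two_le_ker_fullAct))
    (Submodule.finrank_mono (tensorPart_one_inf_tensorPart_two_le hinj))

end

/-! ### Generating series -/

/-- The generating series of a sequence of natural numbers, such as dimensions indexed by the
weight; unlike `genSeries`, it includes the constant term. -/
def natSeries (f : ℕ → ℕ) : PowerSeries ℚ := PowerSeries.mk fun n => (f n : ℚ)

section

variable {f g : ℕ → ℕ}

lemma coeff_natSeries (f : ℕ → ℕ) (n : ℕ) : PowerSeries.coeff n (natSeries f) = f n :=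
  PowerSeries.coeff_mk ..

lemma natSeries_inj : natSeries f = natSeries g ↔ f = g := by
  simp only [PowerSeries.ext_iff, coeff_natSeries, Nat.cast_inj, funext_iff]

lemma natSeries_mul (f g : ℕ → ℕ) : natSeries f * natSeries g =
    natSeries fun n => ∑ p ∈ Finset.HasAntidiagonal.antidiagonal n, f p.1 * g p.2 := by
  ext n
  simp only [PowerSeries.coeff_mul, coeff_natSeries, Nat.cast_sum, Nat.cast_mul]

lemma natSeries_add (f g : ℕ → ℕ) : natSeries f + natSeries g = natSeries (f + g) := by
  ext n
  simp only [map_add, coeff_natSeries, Pi.add_apply, Nat.cast_add]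

lemma genSeries_eq_natSeries (h : f 0 = 0) : genSeries f = natSeries f := by
  ext n
  rw [genSeries, PowerSeries.coeff_mk, coeff_natSeries]
  split_ifs with hn
  · rfl
  · rw [Nat.eq_zero_of_not_pos hn, h, Nat.cast_zero]

end

lemma card_oddIndices_zero (N : ℕ) : (oddIndices N 0).card = if N = 0 then 1 else 0 := by
  split_ifs with h
  · exact Finset.card_eq_one.2 ⟨Fin.elim0, Finset.ext fun m => by
      simp [mem_oddIndices, h, Subsingleton.elim m Fin.elim0]⟩
  · refine Finset.card_eq_zero.2 (Finset.eq_empty_of_forall_notMem fun m hm => h ?_)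
    simpa using (mem_oddIndices.1 hm).1.symm

lemma card_oddIndices_one (N : ℕ) : (oddIndices N 1).card = if IsLetter N then 1 else 0 := by
  have h_mem (m : Fin 1 → ℕ) : m ∈ oddIndices N 1 ↔ m 0 = N ∧ IsLetter (m 0) := by
    rw [mem_oddIndices, Fin.sum_univ_one, Fin.forall_fin_one]
  split_ifs with h
  · refine Finset.card_eq_one.2 ⟨fun _ => N, Finset.ext fun m => ?_⟩
    rw [h_mem, Finset.mem_singleton, funext_iff, Fin.forall_fin_one]
    exact ⟨And.left, fun hm => ⟨hm, hm ▸ h⟩⟩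
  · refine Finset.card_eq_zero.2 (Finset.eq_empty_of_forall_notMem fun m hm => h ?_)
    obtain ⟨h_eq, h_letter⟩ := (h_mem m).1 hm
    exact h_eq ▸ h_letter

lemma card_oddIndices_add (N a b : ℕ) : (oddIndices N (a + b)).card =
    ∑ p ∈ Finset.HasAntidiagonal.antidiagonal N,
      (oddIndices p.1 a).card * (oddIndices p.2 b).card := by
  have h_top : tensorPart N a b ⊤ ⊤ = ⊤ ⊓ gradedPart N (a + b) := by
    ext z
    simp [mem_tensorPart]
  rw [← finrank_top_inf_gradedPart, ← h_top, finrank_tensorPart]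
  simp only [finrank_top_inf_gradedPart]

lemma oddSeries_eq_natSeries : oddSeries = natSeries fun N => (oddIndices N 1).card := by
  rw [oddSeries, eq_comm, PowerSeries.eq_mul_inv_iff_mul_eq (by simp)]
  ext n
  rw [mul_sub, mul_one, map_sub, PowerSeries.coeff_mul_X_pow', coeff_natSeries,
    PowerSeries.coeff_X_pow]
  simp only [coeff_natSeries, card_oddIndices_one, IsLetter, Nat.odd_iff]
  split_ifs <;> first | omega | simp

lemma natSeries_card_oddIndices (r : ℕ) :
    natSeries (fun N => (oddIndices N r).card) = oddSeries ^ r := by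
  induction r with
  | zero =>
    ext n
    rw [coeff_natSeries, card_oddIndices_zero, pow_zero, PowerSeries.coeff_one, Nat.cast_ite,
      Nat.cast_one, Nat.cast_zero]
  | succ r ih =>
    rw [pow_succ, ← ih, oddSeries_eq_natSeries, natSeries_mul]
    simp only [card_oddIndices_add]

lemma cuspDim_add_cuspDim (n : ℕ) : cuspDim n + (if 10 ≤ n then cuspDim (n - 10) else 0) =
    (if 4 ≤ n then cuspDim (n - 4) else 0) + (if 6 ≤ n then cuspDim (n - 6) else 0) +
      (if n = 12 then 1 else 0) := by
  simp only [cuspDim, Nat.even_iff]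
  split_ifs <;> omega

lemma cuspSeries_eq_natSeries : cuspSeries = natSeries cuspDim := by
  rw [cuspSeries, eq_comm, PowerSeries.eq_mul_inv_iff_mul_eq (by simp)]
  have h_expand : natSeries cuspDim * ((1 - PowerSeries.X ^ 4) * (1 - PowerSeries.X ^ 6)) =
      natSeries cuspDim + natSeries cuspDim * PowerSeries.X ^ 10 -
        (natSeries cuspDim * PowerSeries.X ^ 4 + natSeries cuspDim * PowerSeries.X ^ 6) := by
    ring
  rw [h_expand, sub_eq_iff_eq_add']
  ext n
  simp only [map_add, PowerSeries.coeff_mul_X_pow', coeff_natSeries, PowerSeries.coeff_X_pow]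
  exact_mod_cast cuspDim_add_cuspDim n

lemma two_mul_cuspDim_le (N : ℕ) : 2 * cuspDim N ≤ (oddIndices N 2).card := by
  rw [cuspDim]
  split_ifs with hN
  · have h_card : (Finset.range ((N - 4) / 2)).card ≤ (oddIndices N 2).card := by
      refine Finset.card_le_card_of_injOn (fun i => ![2 * i + 3, N - (2 * i + 3)])
        (fun i hi => ?_) fun i _ j _ hij => ?_
      · rw [Finset.mem_coe, Finset.mem_range] at hi
        rw [Nat.even_iff] at hN
        rw [Finset.mem_coe, mem_oddIndices, Fin.sum_univ_two, Fin.forall_fin_two]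
        simp only [IsLetter, Nat.odd_iff, Matrix.cons_val_zero, Matrix.cons_val_one]
        omega
      · have h_head : 2 * i + 3 = 2 * j + 3 := congrFun hij 0
        omega
    rw [Finset.card_range] at h_card
    omega
  · exact Nat.zero_le _

/-! ### Comparison of coefficients -/

/-- All coefficients of the power series are nonnegative. -/
def IsNonneg {R : Type*} [Semiring R] [PartialOrder R] (f : PowerSeries R) : Prop :=
  ∀ n, 0 ≤ PowerSeries.coeff n f

namespace IsNonneg

variable {R : Type*} [Semiring R] [PartialOrder R] [IsOrderedRing R] {f g : PowerSeries R}

lemma add (hf : IsNonneg f) (hg : IsNonneg g) : IsNonneg (f + g) := fun n => by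
  rw [map_add]
  exact add_nonneg (hf n) (hg n)

lemma mul (hf : IsNonneg f) (hg : IsNonneg g) : IsNonneg (f * g) := fun n => by
  rw [PowerSeries.coeff_mul]
  exact Finset.sum_nonneg fun p _ => mul_nonneg (hf _) (hg _)

end IsNonneg

lemma isNonneg_natSeries (f : ℕ → ℕ) : IsNonneg (natSeries f) := fun n => by
  rw [coeff_natSeries]
  exact Nat.cast_nonneg _

lemma isNonneg_natSeries_sub {f g : ℕ → ℕ} (h : ∀ n, g n ≤ f n) :
    IsNonneg (natSeries f - natSeries g) := fun n => by
  rw [map_sub, coeff_natSeries, coeff_natSeries, sub_nonneg, Nat.cast_le]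
  exact h n

lemma isNonneg_oddSeries : IsNonneg oddSeries :=
  oddSeries_eq_natSeries ▸ isNonneg_natSeries _

lemma isNonneg_cuspSeries : IsNonneg cuspSeries :=
  cuspSeries_eq_natSeries ▸ isNonneg_natSeries _

lemma isNonneg_oddSeries_sq_sub : IsNonneg (oddSeries ^ 2 - (cuspSeries + cuspSeries)) := by
  rw [← natSeries_card_oddIndices, cuspSeries_eq_natSeries, natSeries_add, ← two_mul]
  exact isNonneg_natSeries_sub two_mul_cuspDim_le

/-- The generating series of the dimensions of the kernel of the total action in depth `r`. -/
def kerSeries (r : ℕ) : PowerSeries ℚ := natSeries fun N => kerDim N r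

lemma kerSeries_zero : kerSeries 0 = 0 := by
  ext n
  rw [kerSeries, coeff_natSeries, kerDim_zero, Nat.cast_zero, map_zero]

lemma kerSeries_one : kerSeries 1 = 0 := by
  ext n
  rw [kerSeries, coeff_natSeries, kerDim_one, Nat.cast_zero, map_zero]

lemma isNonneg_kerSeries_sub {k : ℕ}
    (hinj : ∀ N, Function.Injective (tasakaMap N (k + 2) (by omega))) :
    IsNonneg (kerSeries (k + 2) + cuspSeries * kerSeries k -
      (oddSeries * kerSeries (k + 1) + cuspSeries * oddSeries ^ k)) := by
  rw [← natSeries_card_oddIndices, oddSeries_eq_natSeries, cuspSeries_eq_natSeries]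
  simp only [kerSeries, natSeries_mul, natSeries_add]
  exact isNonneg_natSeries_sub fun N => kerDim_add_le (hinj N)

lemma isNonneg_kerSeries_five_sub
    (h_three : ∀ N, Function.Injective (tasakaMap N 3 (by norm_num)))
    (h_four : ∀ N, Function.Injective (tasakaMap N 4 (by norm_num)))
    (h_five : ∀ N, Function.Injective (tasakaMap N 5 (by norm_num))) :
    IsNonneg (kerSeries 5 - (4 * oddSeries ^ 3 * cuspSeries - 3 * oddSeries * cuspSeries ^ 2)) := by
  have h_two := isNonneg_kerSeries_sub (k := 0) tasakaMap_two_injective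
  replace h_three := isNonneg_kerSeries_sub (k := 1) h_three
  replace h_four := isNonneg_kerSeries_sub (k := 2) h_four
  replace h_five := isNonneg_kerSeries_sub (k := 3) h_five
  simp only [Nat.reduceAdd, kerSeries_zero, kerSeries_one] at h_two h_three h_four h_five
  have h_sq := isNonneg_oddSeries_sq_sub.add isNonneg_cuspSeries
  convert ((h_five.add (isNonneg_oddSeries.mul h_four)).add (h_sq.mul h_three)).add
    ((isNonneg_oddSeries.mul isNonneg_oddSeries_sq_sub).mul h_two) using 1
  ring

instance (r : ℕ) : IsEmpty (Idx 0 (r + 1)) where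
  false m := by
    obtain ⟨h_sum, h_letter⟩ := mem_oddIndices.1 m.2
    have h_zero := Finset.sum_eq_zero_iff.1 h_sum 0 (Finset.mem_univ _)
    have h_three_le := (h_letter 0).1
    omega

lemma genSeries_finrank_rightKer_C (k : ℕ) :
    genSeries (fun N => Module.finrank ℚ (rightKer (C N (k + 2)))) = kerSeries (k + 2) := by
  rw [genSeries_eq_natSeries Module.finrank_zero_of_subsingleton, kerSeries]
  simp only [finrank_rightKer_C]

lemma natSeries_finrank_W (k : ℕ) :
    natSeries (fun N => Module.finrank ℚ (W N (k + 2) (by omega))) =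
      oddSeries ^ k * cuspSeries := by
  rw [mul_comm, ← natSeries_card_oddIndices, cuspSeries_eq_natSeries, natSeries_mul]
  simp only [finrank_W]

theorem tasakaIso_iff {k : ℕ}
    (hinj : ∀ N, Function.Injective (tasakaMap N (k + 2) (by omega))) :
    TasakaIso (k + 2) (by omega) ↔
      genSeries (fun N => Module.finrank ℚ (rightKer (E N (k + 2)).transpose)) =
        oddSeries ^ k * cuspSeries := by
  rw [genSeries_eq_natSeries Module.finrank_zero_of_subsingleton, ← natSeries_finrank_W,
    natSeries_inj, funext_iff]
  refine forall_congr' fun N => ?_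
  rw [and_iff_right (hinj N), ← LinearMap.finrank_range_of_inj (hinj N)]
  exact ⟨fun h => by rw [h],
    fun h => Submodule.eq_of_le_of_finrank_eq (range_tasakaMap_le N k) h.symm⟩

end TotallyOdd

end

open TotallyOdd in
theorem mainTheorem3_general
    (h_three : ∀ N, Function.Injective (tasakaMap N 3 (by norm_num)))
    (h_four : ∀ N, Function.Injective (tasakaMap N 4 (by norm_num)))
    (h_five : ∀ N, Function.Injective (tasakaMap N 5 (by norm_num))) :
    (TasakaIso 3 (by norm_num) ↔
      genSeries (fun N => Module.finrank ℚ (rightKer (E N 3).transpose)) =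
        oddSeries * cuspSeries) ∧
    ∀ N : ℕ,
      PowerSeries.coeff N (4 * oddSeries ^ 3 * cuspSeries - 3 * oddSeries * cuspSeries ^ 2) ≤
        PowerSeries.coeff N (genSeries fun N => Module.finrank ℚ (rightKer (C N 5))) := by
  refine ⟨by simpa only [pow_one] using tasakaIso_iff (k := 1) h_three, fun N => ?_⟩
  rw [genSeries_finrank_rightKer_C, ← sub_nonneg, ← map_sub]
  exact isNonneg_kerSeries_five_sub h_three h_four h_five N

theorem mainTheorem3
    (hinj : ∀ (r : ℕ) (hr : 2 ≤ r) (N : ℕ),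
      Function.Injective (TotallyOdd.tasakaMap N r hr)) :
    (TotallyOdd.TasakaIso 3 (by norm_num) ↔
      TotallyOdd.genSeries (fun N =>
          Module.finrank ℚ (TotallyOdd.rightKer (TotallyOdd.E N 3).transpose)) =
        TotallyOdd.oddSeries * TotallyOdd.cuspSeries) ∧
    (TotallyOdd.genSeries (fun N =>
          Module.finrank ℚ (TotallyOdd.rightKer (TotallyOdd.E N 3).transpose)) =
        TotallyOdd.oddSeries * TotallyOdd.cuspSeries →
      ∀ N : ℕ,
        PowerSeries.coeff N
            (4 * TotallyOdd.oddSeries ^ 3 * TotallyOdd.cuspSeries -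
              3 * TotallyOdd.oddSeries * TotallyOdd.cuspSeries ^ 2) ≤
          PowerSeries.coeff N
            (TotallyOdd.genSeries fun N =>
              Module.finrank ℚ (TotallyOdd.rightKer (TotallyOdd.C N 5)))) :=
  (mainTheorem3_general (hinj 3 _) (hinj 4 _) (hinj 5 _)).imp_right fun h _ => h
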